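/- Let $d\ge 1$ and $L\ge 2$ be integers and let $\alpha\ge d$ be real. Let $\mathbb H^d_L=\bigoplus_{i=1}^\infty(\mathbb Z/L\mathbb Z)^d$ be the hierarchical lattice, with the ultrametric given by $\|x-y\|=L^{\max\{i:\,x_i\ne y_i\}}$ for $x\ne y$. For $\beta>0$ let $\mathbb P_\beta$ be the law of the random graph with vertex set $\mathbb H^d_L$ in which each unordered pair $\{x,y\}$ of distinct vertices is, independently, an edge with probability $1-\exp(-\beta\|x-y\|^{-d-\alpha})$. Let $K_0$ be the connected component of $0$, and let $\chi(\beta)=\mathbb E_\beta|K_0|\in[1,\infty]$ be the susceptibility. 1. If $\alpha=d$, then there exist constants $c,C>0$ depending only on $d$ and $L$ such that $e^{e^{c\beta}}\le\chi(\beta)\le e^{e^{C\beta}}$ for all sufficiently large $\beta$. 2. If $\alpha>d$, then there exists a function $\varepsilon:\mathbb R\to\mathbb R$ (depending on $d$, $L$, $\alpha$) with $\varepsilon(\beta)\to 0$ as $\beta\to\infty$ such that $\chi(\beta)=\beta^{\frac{d}{\alpha-d}-\varepsilon(\beta)}$ for all sufficiently large $\beta$. In particular, $\chi(\beta)$ is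 finite for all sufficiently large $\beta$ in both cases. -/

import Mathlib

open MeasureTheory ProbabilityTheory Filter Topology
open scoped ENNReal

/-- The hierarchical lattice: the direct sum of countably many copies of `(ℤ/Lℤ)^d`. The
coordinates are indexed by `ℕ`, so the coordinate with index `i : ℕ` is the `(i+1)`-st one. -/
abbrev HLattice (d L : ℕ) : Type := ℕ →₀ (Fin d → ZMod L)

namespace HLattice

variable {d L : ℕ}

/-- The hierarchical ultrametric: `L ^ max {i ≥ 1 : x_i ≠ y_i}` for `x ≠ y`, and `0` if `x = y`.
The support of `x - y` is the set of indices at which `x` and `y` differ. -/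
noncomputable def hdist (x y : HLattice d L) : ℝ :=
  open Classical in
  if x = y then 0 else (L : ℝ) ^ ((x - y).support.sup fun i => i + 1)

theorem hdist_comm (x y : HLattice d L) : hdist x y = hdist y x := by
  have h : (x - y).support = (y - x).support := by
    rw [← neg_sub y x, Finsupp.support_neg]
  simp only [hdist, h, eq_comm]

/-- The possible edges: unordered pairs of distinct vertices. -/
abbrev Edge (d L : ℕ) : Type := {e : Sym2 (HLattice d L) // ¬ e.IsDiag}

/-- The distance between the two endpoints of an edge. -/
noncomputable def edgeLength (e : Edge d L) : ℝ :=
  Sym2.lift ⟨hdist, hdist_comm⟩ e.1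

/-- The probability `1 - exp (-β ‖x-y‖^(-d-α))` that the edge `xy` is open. For `β ≥ 0` this
number lies in `[0, 1]` and the projection to the unit interval does nothing. -/
noncomputable def edgeProb (α β : ℝ) (e : Edge d L) : unitInterval :=
  Set.projIcc 0 1 zero_le_one (1 - Real.exp (-β * edgeLength e ^ (-(d : ℝ) - α)))

/-- The law `ℙ_β` of long-range percolation: the product over all possible edges of the
Bernoulli measures giving mass `edgeProb α β e` to `true` (the edge `e` is open). -/
noncomputable def percMeasure (d L : ℕ) (α β : ℝ) : Measure (Edge d L → Bool) :=
  Measure.infinitePi fun e => bernoulliMeasure true false (edgeProb α β e)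

/-- The random graph whose edges are the open edges of the configuration `ω`. -/
def openGraph (ω : Edge d L → Bool) : SimpleGraph (HLattice d L) where
  Adj x y := ∃ h : x ≠ y, ω ⟨s(x, y), Sym2.mk_isDiag_iff.not.mpr h⟩ = true
  symm := ⟨fun x y ⟨h, hω⟩ => ⟨h.symm, by simpa only [Sym2.eq_swap] using hω⟩⟩
  loopless := ⟨fun _ ⟨h, _⟩ => h rfl⟩

/-- The cluster `K_x` of the vertex `x`: its connected component in the open graph. -/
def cluster (ω : Edge d L → Bool) (x : HLattice d L) : Set (HLattice d L) :=
  {y | (openGraph ω).Reachable x y}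

/-- The susceptibility `χ(β) = 𝔼_β |K_0|`, as an extended nonnegative number. -/
noncomputable def susceptibility (d L : ℕ) (α β : ℝ) : ℝ≥0∞ :=
  ∫⁻ ω, ((cluster ω 0).encard : ℝ≥0∞) ∂(percMeasure d L α β)

end HLattice

/-! Write N = L^d, so that a ball of radius L^n (a `block` of level n) has N^n points.

All upper bounds rest on a finite-volume criterion. The total rate from a point to the outside of
its level-n block is at most L^(-αn). Cutting a path at its last exit from the cluster inside that
block (`connProb_le`) shows that if mean cluster sizes in level-n blocks are at most s and s β
L^(-αn) ≤ 1/2, then χ ≤ 2s (`susceptibility_le_two_mul`).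

For α > d, taking s = N^n turns the criterion into β L^(-(α-d)n) ≤ 1/2, giving χ = O(β^(d/(α-d))).
Conversely, if β L^(-(α-d)n) is about (log β)^2, a union bound over pairs of sibling blocks shows
that a level-n block is connected with probability at least 1/2 (`le_susceptibility_of_connected`).
The two bounds differ by a power of log β, which the function ε absorbs.

For α = d the total rate out of a block is bounded uniformly in its level. Hence at each of the
scales 0, s, 2s, ... the block around a point is cut off from the next annulus with probability at
least e^(-β), independently over scales. With s of order β, edges jumping over a whole annulus are
negligible. Among about β e^β scales some block is therefore isolated with high probability, which
makes the mean cluster size a small enough fraction of the volume for the criterion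
(`meanSize_le_of_scales`). The volume involved is doubly exponential in β.

The lower bound for α = d follows the proportion of a block missed by its largest cluster, the
`defect`. When M blocks merge, two clusters each filling half of their block fail to be joined with
probability at most exp(-β/(4M^2)). Outside this event the new defect is at most the average of the
old ones, with a block of defect above 1/2 penalised. Controlling the first two moments together
(`defect_moments_step`) keeps the defect small through exponentially many levels in β, since
averaging independent blocks contracts the variance. -/

namespace HLattice

/-! ### Events depending on finitely many edges, and the law of the edges -/

section

section FiniteDependence

variable {ι : Type*} {μ : ι → Measure Bool} [∀ i, IsProbabilityMeasure (μ i)]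
  {β γ : Type*} {S T : Set ι}

/-- `F` factors through a finite power of `Bool`, on which every function is measurable. All
finite-volume measurability goes through this remark. -/
theorem measurable_of_dependsOn [MeasurableSpace β] {F : (ι → Bool) → β}
    (hF : DependsOn F S) (hS : S.Finite) : Measurable F := by
  have : Nonempty β := ⟨F fun _ => true⟩
  obtain ⟨g, rfl⟩ := dependsOn_iff_exists_comp.1 hF
  have := hS.to_subtype
  have hg : Measurable g := measurable_of_countable g
  exact hg.comp (measurable_pi_lambda _ fun i => measurable_pi_apply _)

theorem measurableSet_of_dependsOn {A : Set (ι → Bool)}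
    (hA : DependsOn (fun ω => ω ∈ A) S) (hS : S.Finite) : MeasurableSet A :=
  measurable_mem.1 (measurable_of_dependsOn hA hS)

theorem indepFun_of_dependsOn [MeasurableSpace β] [MeasurableSpace γ]
    {F : (ι → Bool) → β} {G : (ι → Bool) → γ} (hF : DependsOn F S) (hG : DependsOn G T)
    (hS : S.Finite) (hT : T.Finite) (hST : Disjoint S T) :
    IndepFun F G (Measure.infinitePi μ) := by
  lift S to Finset ι using hS
  lift T to Finset ι using hT
  have : Nonempty β := ⟨F fun _ => true⟩
  have : Nonempty γ := ⟨G fun _ => true⟩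
  obtain ⟨f, rfl⟩ := dependsOn_iff_exists_comp.1 hF
  obtain ⟨g, rfl⟩ := dependsOn_iff_exists_comp.1 hG
  have h := iIndepFun_infinitePi (P := μ) (X := fun _ b => b) (fun i => measurable_id)
  have h2 := h.indepFun_finset S T (Finset.disjoint_coe.1 hST) (fun i => measurable_pi_apply i)
  exact h2.comp (measurable_of_countable f) (measurable_of_countable g)

theorem measure_inter_of_dependsOn {A B : Set (ι → Bool)}
    (hA : DependsOn (fun ω => ω ∈ A) S) (hB : DependsOn (fun ω => ω ∈ B) T)
    (hS : S.Finite) (hT : T.Finite) (hST : Disjoint S T) :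
    Measure.infinitePi μ (A ∩ B) = Measure.infinitePi μ A * Measure.infinitePi μ B := by
  have h := (indepFun_of_dependsOn (μ := μ) hA hB hS hT hST).measure_inter_preimage_eq_mul
    {True} {True} trivial trivial
  have hmem : ∀ C : Set (ι → Bool), (fun ω => ω ∈ C) ⁻¹' {True} = C := fun C => by
    ext; simp
  rwa [hmem, hmem] at h

end FiniteDependence

variable {d L : ℕ} {α β : ℝ}

instance : IsProbabilityMeasure (percMeasure d L α β) := by
  unfold percMeasure; infer_instance

theorem hdist_nonneg (x y : HLattice d L) : 0 ≤ hdist x y := by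
  unfold hdist; split_ifs <;> positivity

/-- The rate `‖x-y‖^(-d-α)` of the edge `xy` at `β = 1`. -/
noncomputable def rate (α : ℝ) (x y : HLattice d L) : ℝ := hdist x y ^ (-(d : ℝ) - α)

theorem rate_nonneg (x y : HLattice d L) : 0 ≤ rate α x y :=
  Real.rpow_nonneg (hdist_nonneg x y) _

/-- The edge between two distinct vertices. -/
def mkEdge {x y : HLattice d L} (h : x ≠ y) : Edge d L := ⟨s(x, y), Sym2.mk_isDiag_iff.not.mpr h⟩

theorem edgeLength_mkEdge {x y : HLattice d L} (h : x ≠ y) :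
    edgeLength (mkEdge h) = hdist x y := rfl

theorem measure_closed (hβ : 0 ≤ β) {x y : HLattice d L} (h : x ≠ y) :
    percMeasure d L α β {ω | ω (mkEdge h) = false} =
      ENNReal.ofReal (Real.exp (-(β * rate α x y))) := by
  have h1 := Measure.infinitePi_map_eval
    (fun e : Edge d L => bernoulliMeasure true false (edgeProb α β e)) (mkEdge h)
  have h2 : {ω : Edge d L → Bool | ω (mkEdge h) = false} =
    (fun ω => ω (mkEdge h)) ⁻¹' {false} := rfl
  rw [percMeasure, h2, ← Measure.map_apply (measurable_pi_apply _) (measurableSet_singleton _)]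
  erw [h1]
  rw [bernoulliMeasure_apply_of_notMem_of_mem _ (measurableSet_singleton _) (by simp) (by simp)]
  have h0 : 0 ≤ β * rate α x y := mul_nonneg hβ (rate_nonneg x y)
  have hp : ((edgeProb α β (mkEdge h) : unitInterval) : ℝ)
      = 1 - Real.exp (-(β * rate α x y)) := by
    rw [edgeProb, Set.projIcc_of_mem _ ⟨?_, ?_⟩]
    · simp only [edgeLength_mkEdge, rate, neg_mul]
    · simp only [edgeLength_mkEdge, neg_mul, sub_nonneg, Real.exp_le_one_iff]
      simpa [rate] using h0
    · simp only [tsub_le_iff_right, le_add_iff_nonneg_right]; positivity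
  rw [ENNReal.ofReal, ENNReal.coe_inj]
  ext
  simp [hp, Real.exp_nonneg]

theorem measure_open_le (hβ : 0 ≤ β) {x y : HLattice d L} (h : x ≠ y) :
    percMeasure d L α β {ω | ω (mkEdge h) = true} ≤ ENNReal.ofReal (β * rate α x y) := by
  have h1 : {ω : Edge d L → Bool | ω (mkEdge h) = true} = {ω | ω (mkEdge h) = false}ᶜ := by
    ext; simp
  have hm : MeasurableSet {ω : Edge d L → Bool | ω (mkEdge h) = false} :=
    (measurable_pi_apply (mkEdge h) : Measurable fun ω : Edge d L → Bool => ω (mkEdge h))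
      (measurableSet_singleton false)
  rw [h1, prob_compl_eq_one_sub hm, measure_closed hβ h, ← ENNReal.ofReal_one,
    ← ENNReal.ofReal_sub _ (Real.exp_nonneg _)]
  apply ENNReal.ofReal_le_ofReal
  linarith [Real.add_one_le_exp (-(β * rate α x y))]

/-- No open edge joins `A` and `B`. -/
def noEdge (A B : Finset (HLattice d L)) : Set (Edge d L → Bool) :=
  {ω | ∀ a ∈ A, ∀ b ∈ B, ¬ (openGraph ω).Adj a b}

/-- The edges with one endpoint in `A` and the other one in `B`. -/
def crossEdges (A B : Finset (HLattice d L)) : Set (Edge d L) :=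
  {e | ∃ a ∈ A, ∃ b ∈ B, e.1 = s(a, b)}

theorem finite_crossEdges (A B : Finset (HLattice d L)) : (crossEdges A B).Finite := by
  refine Set.Finite.of_finite_image (f := Subtype.val) (Set.Finite.subset
    (((A ×ˢ B).finite_toSet).image fun p => s(p.1, p.2)) ?_) Subtype.val_injective.injOn
  rintro _ ⟨e, ⟨a, ha, b, hb, h⟩, rfl⟩
  exact ⟨(a, b), by simp [ha, hb], h.symm⟩

theorem adj_iff {ω : Edge d L → Bool} {x y : HLattice d L} (h : x ≠ y) :
    (openGraph ω).Adj x y ↔ ω (mkEdge h) = true :=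
  ⟨fun ⟨_, h'⟩ => h', fun h' => ⟨h, h'⟩⟩

theorem adj_congr {ω ω' : Edge d L → Bool} {x y : HLattice d L}
    (h : ∀ h : x ≠ y, ω (mkEdge h) = ω' (mkEdge h)) :
    (openGraph ω).Adj x y ↔ (openGraph ω').Adj x y := by
  by_cases hxy : x = y
  · subst hxy; simp
  · rw [adj_iff hxy, adj_iff hxy, h hxy]

theorem dependsOn_noEdge (A B : Finset (HLattice d L)) :
    DependsOn (fun ω => ω ∈ noEdge A B) (crossEdges A B) := by
  intro ω ω' h
  refine propext (forall₂_congr fun a ha => forall₂_congr fun b hb => not_congr ?_)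
  exact adj_congr fun hab => h _ ⟨a, ha, b, hb, rfl⟩

theorem measurableSet_noEdge (A B : Finset (HLattice d L)) : MeasurableSet (noEdge A B) :=
  measurableSet_of_dependsOn (dependsOn_noEdge A B) (finite_crossEdges A B)

/-- Since `A` and `B` are disjoint, distinct pairs give distinct unordered edges. The event is thus
a cylinder, and its factors multiply to the exponential of the total rate. -/
theorem measure_noEdge (hβ : 0 ≤ β) {A B : Finset (HLattice d L)} (hAB : Disjoint A B) :
    percMeasure d L α β (noEdge A B) =
      ENNReal.ofReal (Real.exp (-(β * ∑ a ∈ A, ∑ b ∈ B, rate α a b))) := by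
  classical
  let s : Finset (Edge d L) := (finite_crossEdges A B).toFinset
  have hne : ∀ p : (A ×ˢ B : Finset _), p.1.1 ≠ p.1.2 := fun p h => by
    have := Finset.mem_product.1 p.2
    exact Finset.disjoint_left.1 hAB this.1 (h ▸ this.2)
  let f : (A ×ˢ B : Finset _) → Edge d L := fun p => mkEdge (hne p)
  have hf : Function.Injective f := by
    rintro ⟨⟨a, b⟩, hp⟩ ⟨⟨a', b'⟩, hp'⟩ h
    have h1 : s(a, b) = s(a', b') := congrArg Subtype.val h
    simp only [Finset.mem_product] at hp hp'
    rcases Sym2.eq_iff.1 h1 with ⟨rfl, rfl⟩ | ⟨rfl, rfl⟩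
    · rfl
    · exact (Finset.disjoint_left.1 hAB hp.1 hp'.2).elim
  have h1 : noEdge A B = Set.pi (Finset.univ.map ⟨f, hf⟩ : Finset (Edge d L))
      (fun _ => ({false} : Set Bool)) := by
    ext ω
    constructor
    · intro h e he
      simp only [Finset.coe_map, Set.mem_image] at he
      obtain ⟨p, -, rfl⟩ := he
      have hp := Finset.mem_product.1 p.2
      have := h _ hp.1 _ hp.2
      rw [adj_iff (hne p)] at this
      simpa [f] using this
    · intro h a ha b hb
      have hp : (a, b) ∈ A ×ˢ B := by simp [ha, hb]
      have := h (f ⟨(a, b), hp⟩) (by simp)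
      rw [adj_iff (hne ⟨(a, b), hp⟩)]
      simpa [f] using this
  rw [h1, percMeasure, Measure.infinitePi_pi _ (fun i _ => measurableSet_singleton _),
    Finset.prod_map]
  have h2 : ∀ p : (A ×ˢ B : Finset _),
      bernoulliMeasure true false (edgeProb α β (f p)) {false}
        = ENNReal.ofReal (Real.exp (-(β * rate α p.1.1 p.1.2))) := by
    intro p
    rw [← measure_closed hβ (hne p), percMeasure]
    exact (Measure.infinitePi_map_eval
      (fun e : Edge d L => bernoulliMeasure true false (edgeProb α β e)) (f p) ▸
      Measure.map_apply (measurable_pi_apply _) (measurableSet_singleton _))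
  simp only [Function.Embedding.coeFn_mk, h2]
  rw [← ENNReal.ofReal_prod_of_nonneg (fun _ _ => Real.exp_nonneg _), ← Real.exp_sum,
    Finset.sum_coe_sort (A ×ˢ B) (fun p => -(β * rate α p.1 p.2)), Finset.sum_neg_distrib,
    ← Finset.mul_sum, Finset.sum_product]

end

/-! ### Geometry of blocks and sums of rates -/

section

variable {d L : ℕ} {α β : ℝ}

/-- The index of the last coordinate at which `x` and `y` differ, counted from `1`. -/
noncomputable def level (x y : HLattice d L) : ℕ := (x - y).support.sup fun i => i + 1

theorem level_le_iff {x y : HLattice d L} {n : ℕ} :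
    level x y ≤ n ↔ ∀ i, n ≤ i → y i = x i := by
  simp only [level, Finset.sup_le_iff, Finsupp.mem_support_iff, Finsupp.sub_apply, ne_eq]
  constructor
  · intro h i hi
    by_contra hne
    have := h i (fun h0 => hne (sub_eq_zero.1 h0).symm)
    omega
  · intro h i hi
    by_contra hlt
    exact hi (sub_eq_zero.2 (h i (by omega)).symm)

theorem level_comm (x y : HLattice d L) : level x y = level y x :=
  le_antisymm (level_le_iff.2 fun i hi => (level_le_iff.1 le_rfl i hi).symm)
    (level_le_iff.2 fun i hi => (level_le_iff.1 le_rfl i hi).symm)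

theorem level_pos {x y : HLattice d L} (h : x ≠ y) : 0 < level x y := by
  by_contra h0
  exact h (Finsupp.ext fun i => (level_le_iff.1 (Nat.le_of_not_lt h0) i (Nat.zero_le i)).symm)

theorem rate_of_ne {x y : HLattice d L} (h : x ≠ y) :
    rate α x y = ((L : ℝ) ^ level x y) ^ (-(d : ℝ) - α) := by
  rw [rate, hdist, if_neg h, level]

theorem finite_block [NeZero L] (n : ℕ) (x : HLattice d L) :
    {y : HLattice d L | ∀ i, n ≤ i → y i = x i}.Finite := by
  refine Set.Finite.of_finite_image (f := fun y => fun i : Fin n => y i) (Set.toFinite _) ?_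
  intro y hy z hz hyz
  ext1 i
  by_cases hi : i < n
  · exact congrFun hyz ⟨i, hi⟩
  · rw [hy i (by omega), hz i (by omega)]

/-- The ball of radius `L ^ n` around `x`. -/
noncomputable def block [NeZero L] (n : ℕ) (x : HLattice d L) : Finset (HLattice d L) :=
  (finite_block n x).toFinset

variable [NeZero L] {m n k : ℕ} {x y z : HLattice d L}

theorem mem_block : y ∈ block n x ↔ ∀ i, n ≤ i → y i = x i := by
  simp [block]

theorem mem_block_iff_level : y ∈ block n x ↔ level x y ≤ n := by
  rw [mem_block, level_le_iff]

theorem self_mem_block : x ∈ block n x := mem_block.2 fun _ _ => rfl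

theorem block_eq_of_mem (h : y ∈ block n x) : block n y = block n x := by
  ext z
  rw [mem_block, mem_block]
  exact forall₂_congr fun i hi => by rw [mem_block.1 h i hi]

theorem block_mono (h : m ≤ n) : block m x ⊆ block n x := fun _ hy =>
  mem_block.2 fun i hi => mem_block.1 hy i (h.trans hi)

theorem exists_mem_block (x y : HLattice d L) : ∃ n, y ∈ block n x :=
  ⟨level x y, mem_block_iff_level.2 le_rfl⟩

theorem disjoint_block (h : y ∉ block n x) : Disjoint (block n x) (block n y) := by
  rw [Finset.disjoint_left]
  intro z hx hy
  rw [← block_eq_of_mem hx, block_eq_of_mem hy] at h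
  exact h self_mem_block

theorem card_block (n : ℕ) (x : HLattice d L) : (block n x).card = (L ^ d) ^ n := by
  have h : (block n x).card = Fintype.card (Fin n → Fin d → ZMod L) := by
    rw [← Finset.card_univ]
    refine Finset.card_bij (fun y _ i => y i) (fun _ _ => Finset.mem_univ _) ?_ ?_
    · intro y hy z hz hyz
      ext1 i
      by_cases hi : i < n
      · exact congrFun hyz ⟨i, hi⟩
      · rw [mem_block.1 hy i (by omega), mem_block.1 hz i (by omega)]
    · intro g _
      classical
      refine ⟨Finsupp.onFinset (Finset.range n ∪ x.support)
        (fun i => if hi : i < n then g ⟨i, hi⟩ else x i) ?_, ?_, ?_⟩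
      · intro i hi
        by_cases h : i < n
        · simp [h]
        · simp only [h, dite_false] at hi
          simp [hi]
      · refine mem_block.2 fun i hi => ?_
        simp [Nat.not_lt.2 hi]
      · ext1 i
        simp
  rw [h]
  simp [ZMod.card]

/-- The blocks of level `n` contained in the block of level `n + k` around `x`. -/
noncomputable def children (n k : ℕ) (x : HLattice d L) : Finset (Finset (HLattice d L)) :=
  (block (n + k) x).image (block n)

theorem mem_children {c : Finset (HLattice d L)} :
    c ∈ children n k x ↔ ∃ y ∈ block (n + k) x, block n y = c := by
  simp [children]

theorem pairwiseDisjoint_children :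
    ((children n k x : Finset _) : Set (Finset (HLattice d L))).PairwiseDisjoint id := by
  rintro a ha b hb hab
  obtain ⟨y, -, rfl⟩ := mem_children.1 ha
  obtain ⟨z, -, rfl⟩ := mem_children.1 hb
  exact disjoint_block fun h => hab (block_eq_of_mem h).symm

theorem biUnion_children : (children n k x).biUnion id = block (n + k) x := by
  ext y
  simp only [Finset.mem_biUnion, id]
  constructor
  · rintro ⟨c, hc, hy⟩
    obtain ⟨z, hz, rfl⟩ := mem_children.1 hc
    rw [← block_eq_of_mem hz]
    exact block_mono (by omega) hy
  · exact fun h => ⟨_, mem_children.2 ⟨y, h, rfl⟩, self_mem_block⟩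

theorem subset_of_mem_children {c : Finset (HLattice d L)} (hc : c ∈ children n k x) :
    c ⊆ block (n + k) x := by
  rw [← biUnion_children]
  exact Finset.subset_biUnion_of_mem id hc

theorem card_of_mem_children {c : Finset (HLattice d L)} (hc : c ∈ children n k x) :
    c.card = (L ^ d) ^ n := by
  obtain ⟨z, -, rfl⟩ := mem_children.1 hc
  exact card_block n z

theorem card_children : (children n k x).card = (L ^ d) ^ k := by
  have h := Finset.card_biUnion (pairwiseDisjoint_children (n := n) (k := k) (x := x))
  have h0 : 0 < (L ^ d) ^ n := pow_pos (pow_pos (NeZero.pos L) _) _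
  rw [biUnion_children, card_block,
    Finset.sum_congr rfl fun c hc => (card_of_mem_children hc : (id c).card = _),
    Finset.sum_const, smul_eq_mul, pow_add, mul_comm] at h
  exact (Nat.eq_of_mul_eq_mul_right h0 h).symm

theorem rate_ge_of_mem_block (hα : 0 ≤ α) (h : y ∈ block n x) (hne : x ≠ y) :
    ((L : ℝ) ^ n) ^ (-(d : ℝ) - α) ≤ rate α x y := by
  have hL : (1 : ℝ) ≤ L := by exact_mod_cast NeZero.one_le
  rw [rate_of_ne hne]
  refine Real.rpow_le_rpow_of_nonpos (by positivity)
    (pow_le_pow_right₀ hL (mem_block_iff_level.1 h)) ?_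
  have : (0 : ℝ) ≤ d := by positivity
  linarith

theorem rate_le_of_notMem_block (hα : 0 ≤ α) (h : y ∉ block n x) :
    rate α x y ≤ ((L : ℝ) ^ (n + 1)) ^ (-(d : ℝ) - α) := by
  have hL : (1 : ℝ) ≤ L := by exact_mod_cast NeZero.one_le
  have hne : x ≠ y := fun hxy => h (hxy ▸ self_mem_block)
  rw [rate_of_ne hne]
  refine Real.rpow_le_rpow_of_nonpos (by positivity)
    (pow_le_pow_right₀ hL ?_) ?_
  · rw [mem_block_iff_level] at h; omega
  have : (0 : ℝ) ≤ d := by positivity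
  linarith

/-- At most L^(d(m+1)) points lie at distance L^(m+1), each with rate L^(-(d+α)(m+1)), so the layers
are dominated by a geometric series of ratio L^(-α) ≤ 1/2. -/
theorem sum_rate_le (hL : 2 ≤ L) (hα : 1 ≤ α) (h : n ≤ m) (x : HLattice d L) :
    ∑ y ∈ block m x \ block n x, rate α x y ≤ ((L : ℝ) ^ (-α)) ^ n := by
  have hL' : (2 : ℝ) ≤ L := by exact_mod_cast hL
  have hL0 : (0 : ℝ) < L := by linarith
  have hq : (L : ℝ) ^ (-α) ≤ 1 / 2 := by
    calc (L : ℝ) ^ (-α) ≤ (L : ℝ) ^ (-1 : ℝ) :=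
          Real.rpow_le_rpow_of_exponent_le (by linarith) (by linarith)
      _ = (L : ℝ)⁻¹ := Real.rpow_neg_one _
      _ ≤ 1 / 2 := by rw [one_div]; exact inv_anti₀ (by norm_num) hL'
  set q : ℝ := (L : ℝ) ^ (-α) with hqdef
  have hq0 : 0 < q := Real.rpow_pos_of_pos hL0 _
  -- The subtracted term closes the induction: q ≤ 1/2 gives q^(m+1) ≤ q^m - q^(m+1), and no
  -- constant is lost.
  have key : ∑ y ∈ block m x \ block n x, rate α x y ≤ q ^ n - q ^ m := by
    induction m, h using Nat.le_induction with
    | base => simp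
    | succ m h ih =>
      have hsub : block m x \ block n x ⊆ block (m + 1) x \ block n x :=
        Finset.sdiff_subset_sdiff (block_mono (by omega)) le_rfl
      rw [← Finset.sum_sdiff hsub]
      have h1 : ∑ y ∈ (block (m + 1) x \ block n x) \ (block m x \ block n x), rate α x y
          ≤ q ^ (m + 1) := by
        calc _ ≤ ∑ y ∈ (block (m + 1) x \ block n x) \ (block m x \ block n x),
              ((L : ℝ) ^ (m + 1)) ^ (-(d : ℝ) - α) := by
              refine Finset.sum_le_sum fun y hy => rate_le_of_notMem_block (by linarith) ?_
              simp only [Finset.mem_sdiff] at hy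
              tauto
          _ ≤ ((L ^ d) ^ (m + 1) : ℕ) * ((L : ℝ) ^ (m + 1)) ^ (-(d : ℝ) - α) := by
              rw [Finset.sum_const, nsmul_eq_mul]
              refine mul_le_mul_of_nonneg_right ?_ (by positivity)
              rw [← card_block (m + 1) x]
              exact_mod_cast Finset.card_le_card
                (Finset.sdiff_subset.trans Finset.sdiff_subset)
          _ = q ^ (m + 1) := by
              rw [hqdef, ← Real.rpow_natCast, ← Real.rpow_natCast, ← Real.rpow_mul hL0.le,
                ← Real.rpow_mul hL0.le]
              push_cast
              rw [← Real.rpow_natCast, ← Real.rpow_natCast, ← Real.rpow_mul hL0.le,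
                ← Real.rpow_add hL0]
              congr 1
              push_cast
              ring
      have h2 : q ^ (m + 1) ≤ q ^ m / 2 := by
        rw [pow_succ]
        nlinarith [pow_pos hq0 m]
      linarith
  linarith [pow_pos hq0 m]

end

/-! ### Clusters in finite volume and the last-exit inequality -/

section

variable {d L : ℕ} {α β : ℝ}

/-- The graph formed by the open edges inside `Λ`. -/
def graphIn (Λ : Finset (HLattice d L)) (ω : Edge d L → Bool) : SimpleGraph (HLattice d L) where
  Adj x y := (openGraph ω).Adj x y ∧ x ∈ Λ ∧ y ∈ Λ
  symm := ⟨fun _ _ h => ⟨h.1.symm, h.2.2, h.2.1⟩⟩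
  loopless := ⟨fun x h => (openGraph ω).loopless.irrefl x h.1⟩

open Classical in
/-- The cluster of `x` in the graph formed by the open edges inside `Λ`. -/
noncomputable def clusterIn (Λ : Finset (HLattice d L)) (ω : Edge d L → Bool)
    (x : HLattice d L) : Finset (HLattice d L) :=
  Λ.filter fun y => (graphIn Λ ω).Reachable x y

/-- The edges with both endpoints in `Λ`. -/
abbrev edgesIn (Λ : Finset (HLattice d L)) : Set (Edge d L) := crossEdges Λ Λ

variable {Λ B c : Finset (HLattice d L)} {ω ω' : Edge d L → Bool} {x y z : HLattice d L}

theorem mem_clusterIn : y ∈ clusterIn Λ ω x ↔ y ∈ Λ ∧ (graphIn Λ ω).Reachable x y := by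
  classical
  simp [clusterIn]

theorem clusterIn_subset : clusterIn Λ ω x ⊆ Λ := fun _ h => (mem_clusterIn.1 h).1

theorem self_mem_clusterIn (hx : x ∈ Λ) : x ∈ clusterIn Λ ω x :=
  mem_clusterIn.2 ⟨hx, .refl x⟩

theorem mem_clusterIn_of_adj (hy : y ∈ clusterIn Λ ω x) (h : (openGraph ω).Adj y z)
    (hz : z ∈ Λ) : z ∈ clusterIn Λ ω x := by
  rw [mem_clusterIn] at *
  have h1 : (graphIn Λ ω).Adj y z := ⟨h, hy.1, hz⟩
  exact ⟨hz, hy.2.trans h1.reachable⟩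

theorem clusterIn_eq_of_mem (h : y ∈ clusterIn Λ ω x) : clusterIn Λ ω y = clusterIn Λ ω x := by
  have h2 := (mem_clusterIn.1 h).2
  ext z
  rw [mem_clusterIn, mem_clusterIn]
  exact and_congr_right fun _ => ⟨h2.trans, h2.symm.trans⟩

/-- Induction along open paths inside `Λ`. -/
theorem clusterIn_induction {p : HLattice d L → Prop} (hx : p x)
    (hstep : ∀ y ∈ clusterIn Λ ω x, ∀ z ∈ Λ, p y → (openGraph ω).Adj y z → p z)
    (hy : y ∈ clusterIn Λ ω x) : p y := by
  obtain ⟨hyΛ, h⟩ := mem_clusterIn.1 hy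
  clear hy
  rw [SimpleGraph.reachable_iff_reflTransGen] at h
  induction h with
  | refl => exact hx
  | @tail b c hb hbc ih =>
    refine hstep b ?_ c hyΛ (ih hbc.2.1) hbc.1
    rw [mem_clusterIn, SimpleGraph.reachable_iff_reflTransGen]
    exact ⟨hbc.2.1, hb⟩

theorem clusterIn_mono (h : B ⊆ Λ) : clusterIn B ω x ⊆ clusterIn Λ ω x := by
  intro y hy
  have := clusterIn_subset hy
  rw [mem_clusterIn] at *
  refine ⟨h this, hy.2.mono ?_⟩
  exact fun a b hab => ⟨hab.1, h hab.2.1, h hab.2.2⟩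

/-- An open path from `c` to the outside of `c` leaves `c` for the last time at some edge. -/
theorem exists_exit_of_mem_clusterIn (hx : x ∈ c) (hy : y ∈ clusterIn Λ ω x) (hyc : y ∉ c) :
    ∃ u ∈ c, ∃ z ∈ Λ \ c, (openGraph ω).Adj u z ∧ y ∈ clusterIn (Λ \ c) ω z := by
  have key : y ∈ c ∨ ∃ u ∈ c, ∃ z ∈ Λ \ c, (openGraph ω).Adj u z ∧ y ∈ clusterIn (Λ \ c) ω z := by
    refine clusterIn_induction (p := fun y => y ∈ c ∨ ∃ u ∈ c, ∃ z ∈ Λ \ c,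
      (openGraph ω).Adj u z ∧ y ∈ clusterIn (Λ \ c) ω z) (Or.inl hx) ?_ hy
    intro v _ w hw hv hvw
    by_cases hwc : w ∈ c
    · exact Or.inl hwc
    have hw' : w ∈ Λ \ c := Finset.mem_sdiff.2 ⟨hw, hwc⟩
    right
    rcases hv with hv | ⟨u, hu, z, hz, huz, hvz⟩
    · exact ⟨v, hv, w, hw', hvw, self_mem_clusterIn hw'⟩
    · exact ⟨u, hu, z, hz, huz, mem_clusterIn_of_adj hvz hvw hw'⟩
  exact key.resolve_left hyc

theorem dependsOn_graphIn : DependsOn (graphIn Λ) (edgesIn Λ) := by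
  intro ω ω' h
  ext a b
  refine and_congr_left fun hab => adj_congr fun hne => h _ ⟨a, hab.1, b, hab.2, rfl⟩

theorem clusterIn_congr (h : graphIn Λ ω = graphIn Λ ω') :
    clusterIn Λ ω = clusterIn Λ ω' := by
  funext x
  ext y
  rw [mem_clusterIn, mem_clusterIn, h]

theorem dependsOn_clusterIn : DependsOn (clusterIn Λ) (edgesIn Λ) :=
  fun _ _ h => clusterIn_congr (dependsOn_graphIn h)

theorem dependsOn_mem_clusterIn (x y : HLattice d L) :
    DependsOn (fun ω => ω ∈ {ω | y ∈ clusterIn Λ ω x}) (edgesIn Λ) := by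
  intro ω ω' h
  simp only [Set.mem_ofPred_eq, dependsOn_clusterIn h]

/-- Whether the cluster of `x` is `c` is determined by the edges touching `c`. -/
theorem dependsOn_clusterIn_eq (x : HLattice d L) (hx : x ∈ Λ) :
    DependsOn (fun ω => ω ∈ {ω | clusterIn Λ ω x = c}) (crossEdges c Λ) := by
  have key : ∀ ω ω' : Edge d L → Bool, (∀ e ∈ crossEdges c Λ, ω e = ω' e) →
      clusterIn Λ ω x = c → clusterIn Λ ω' x = c := by
    intro ω ω' h hc
    have hadj : ∀ u ∈ c, ∀ v ∈ Λ, (openGraph ω).Adj u v ↔ (openGraph ω').Adj u v :=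
      fun u hu v hv => adj_congr fun hne => h _ ⟨u, hu, v, hv, rfl⟩
    refine Finset.Subset.antisymm (fun y hy => ?_) (fun y hy => ?_)
    · refine clusterIn_induction (p := fun y => y ∈ c) (hc ▸ self_mem_clusterIn hx) ?_ hy
      intro u _ v hv hu huv
      rw [← hadj u hu v hv] at huv
      rw [← hc] at hu ⊢
      exact mem_clusterIn_of_adj hu huv hv
    · rw [← hc] at hy
      refine clusterIn_induction (p := fun y => y ∈ clusterIn Λ ω' x) (self_mem_clusterIn hx)
        ?_ hy
      intro u hu v hv hu' huv
      rw [hc] at hu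
      exact mem_clusterIn_of_adj hu' ((hadj u hu v hv).1 huv) hv
  exact fun ω ω' h => propext ⟨key ω ω' h, key ω' ω fun e he => (h e he).symm⟩

theorem cluster_eq_iUnion [NeZero L] (ω : Edge d L → Bool) (x : HLattice d L) :
    cluster ω x = ⋃ n, (clusterIn (block n x) ω x : Set (HLattice d L)) := by
  ext y
  simp only [Set.mem_iUnion, Finset.mem_coe]
  constructor
  · intro h
    change (openGraph ω).Reachable x y at h
    rw [SimpleGraph.reachable_iff_reflTransGen] at h
    induction h with
    | refl => exact ⟨0, self_mem_clusterIn self_mem_block⟩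
    | @tail b c _ hbc ih =>
      obtain ⟨n, hn⟩ := ih
      obtain ⟨k, hk⟩ := exists_mem_block x c
      exact ⟨max n k, mem_clusterIn_of_adj
        (clusterIn_mono (block_mono (le_max_left n k)) hn) hbc
        (block_mono (le_max_right n k) hk)⟩
  · rintro ⟨n, hn⟩
    have hle : graphIn (block n x) ω ≤ openGraph ω := fun a b h => h.1
    exact (mem_clusterIn.1 hn).2.mono hle

/-- The probability that `x` and `y` are connected inside `Λ`. -/
noncomputable def connProb (α β : ℝ) (Λ : Finset (HLattice d L)) (x y : HLattice d L) : ℝ≥0∞ :=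
  percMeasure d L α β {ω | y ∈ clusterIn Λ ω x}

/-- The mean size of the cluster of `x` inside `Λ`. -/
noncomputable def meanSize (α β : ℝ) (Λ : Finset (HLattice d L)) (x : HLattice d L) : ℝ≥0∞ :=
  ∫⁻ ω, ((clusterIn Λ ω x).card : ℝ≥0∞) ∂(percMeasure d L α β)

theorem measurable_card_clusterIn (x : HLattice d L) :
    Measurable fun ω => ((clusterIn Λ ω x).card : ℝ≥0∞) :=
  measurable_of_dependsOn (S := edgesIn Λ)
    (fun ω ω' h => by simp only [dependsOn_clusterIn h]) (finite_crossEdges _ _)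

theorem measurableSet_mem_clusterIn (x y : HLattice d L) :
    MeasurableSet {ω : Edge d L → Bool | y ∈ clusterIn Λ ω x} :=
  measurableSet_of_dependsOn (dependsOn_mem_clusterIn x y) (finite_crossEdges _ _)

theorem meanSize_eq_sum (x : HLattice d L) :
    meanSize α β Λ x = ∑ y ∈ Λ, connProb α β Λ x y := by
  classical
  have h : ∀ ω : Edge d L → Bool, ((clusterIn Λ ω x).card : ℝ≥0∞) =
      ∑ y ∈ Λ, Set.indicator {ω | y ∈ clusterIn Λ ω x} (fun _ => (1 : ℝ≥0∞)) ω := by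
    intro ω
    rw [← Finset.inter_eq_right.2 (clusterIn_subset (Λ := Λ) (ω := ω) (x := x)),
      ← Finset.filter_mem_eq_inter, Finset.card_filter]
    push_cast
    exact Finset.sum_congr rfl fun y _ => by simp [Set.indicator]
  simp only [meanSize, h]
  rw [lintegral_finsetSum _ fun y _ =>
    measurable_const.indicator (measurableSet_mem_clusterIn x y)]
  refine Finset.sum_congr rfl fun y _ => ?_
  rw [lintegral_indicator_const (measurableSet_mem_clusterIn x y), one_mul, connProb]

theorem meanSize_le_card (x : HLattice d L) : meanSize α β Λ x ≤ Λ.card := by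
  calc meanSize α β Λ x ≤ ∫⁻ _, (Λ.card : ℝ≥0∞) ∂(percMeasure d L α β) :=
        lintegral_mono fun ω => Nat.cast_le.2 (Finset.card_le_card clusterIn_subset)
    _ = Λ.card := by simp

theorem connProb_mono (h : B ⊆ Λ) (x y : HLattice d L) :
    connProb α β B x y ≤ connProb α β Λ x y :=
  measure_mono fun _ hω => clusterIn_mono h hω

theorem disjoint_crossEdges {A A' C C' : Finset (HLattice d L)}
    (h : ∀ a ∈ A, ∀ b ∈ C, ∀ a' ∈ A', ∀ b' ∈ C', ¬ (a = a' ∧ b = b') ∧ ¬ (a = b' ∧ b = a')) :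
    Disjoint (crossEdges A C) (crossEdges A' C') := by
  rw [Set.disjoint_left]
  rintro e ⟨a, ha, b, hb, he⟩ ⟨a', ha', b', hb', he'⟩
  have := h a ha b hb a' ha' b' hb'
  rcases Sym2.eq_iff.1 (he.symm.trans he') with h | h
  · exact this.1 h
  · exact this.2 h

/-- A path from `x` to `y` inside `Λ` either stays in `B`, or leaves the cluster of `x` in `B` for
the last time through an edge from `B` to the complement of `B`. -/
theorem connProb_le (hβ : 0 ≤ β) (hx : x ∈ B) :
    connProb α β Λ x y ≤ connProb α β B x y + ∑ u ∈ B, ∑ z ∈ Λ \ B,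
      connProb α β B x u * ENNReal.ofReal (β * rate α u z) * connProb α β Λ z y := by
  classical
  set P := percMeasure d L α β with hP
  -- The union runs over the value `c` of the cluster of `x` in `B`. Having the rest of the path
  -- avoid `c` makes the three events depend on disjoint edge sets: edges in `B` touching `c`, the
  -- edge `uz`, and edges avoiding `c`. Plain independence then replaces a van den Berg–Kesten
  -- inequality.
  have hsub : {ω : Edge d L → Bool | y ∈ clusterIn Λ ω x} ⊆ {ω | y ∈ clusterIn B ω x} ∪
      ⋃ u ∈ B, ⋃ z ∈ Λ \ B, ⋃ c ∈ B.powerset.filter (u ∈ ·),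
        ({ω | clusterIn B ω x = c} ∩ {ω | (openGraph ω).Adj u z}) ∩
          {ω | y ∈ clusterIn (Λ \ c) ω z} := by
    intro ω hω
    by_cases hy : y ∈ clusterIn B ω x
    · exact Or.inl hy
    · right
      obtain ⟨u, hu, z, hz, huz, hyz⟩ :=
        exists_exit_of_mem_clusterIn (self_mem_clusterIn hx) hω hy
      rw [Finset.mem_sdiff] at hz
      simp only [Set.mem_iUnion]
      refine ⟨u, clusterIn_subset hu, z, Finset.mem_sdiff.2 ⟨hz.1, fun hzB =>
        hz.2 (mem_clusterIn_of_adj hu huz hzB)⟩, clusterIn B ω x, ?_, ⟨rfl, huz⟩, hyz⟩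
      simp [clusterIn_subset, hu]
  refine (measure_mono hsub).trans ((measure_union_le _ _).trans (add_le_add le_rfl ?_))
  refine (measure_biUnion_finset_le _ _).trans (Finset.sum_le_sum fun u hu => ?_)
  refine (measure_biUnion_finset_le _ _).trans (Finset.sum_le_sum fun z hz => ?_)
  refine (measure_biUnion_finset_le _ _).trans ?_
  rw [Finset.mem_sdiff] at hz
  have huz : u ≠ z := fun h => hz.2 (h ▸ hu)
  have hterm : ∀ c ∈ B.powerset.filter (u ∈ ·),
      P (({ω | clusterIn B ω x = c} ∩ {ω | (openGraph ω).Adj u z}) ∩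
          {ω | y ∈ clusterIn (Λ \ c) ω z}) ≤
        P {ω | clusterIn B ω x = c} * (ENNReal.ofReal (β * rate α u z) * connProb α β Λ z y) := by
    intro c hc
    rw [Finset.mem_filter, Finset.mem_powerset] at hc
    have hE : {ω : Edge d L → Bool | (openGraph ω).Adj u z} = {ω | ω (mkEdge huz) = true} := by
      ext ω; exact adj_iff huz
    have hdE : DependsOn (fun ω => ω ∈ {ω : Edge d L → Bool | (openGraph ω).Adj u z})
        (crossEdges {u} {z}) := by
      intro ω ω' h
      exact propext (adj_congr fun hne => h _ ⟨u, by simp, z, by simp, rfl⟩)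
    have hdC := dependsOn_clusterIn_eq (c := c) x hx
    have hdCE : DependsOn (fun ω => ω ∈ {ω | clusterIn B ω x = c} ∩
        {ω | (openGraph ω).Adj u z}) (crossEdges c B ∪ crossEdges {u} {z}) := by
      intro ω ω' h
      have h1 := hdC (fun e he => h e (Or.inl he))
      have h2 := hdE (fun e he => h e (Or.inr he))
      simp only [Set.mem_inter_iff, h1, h2]
    rw [hP, percMeasure, measure_inter_of_dependsOn hdCE (dependsOn_mem_clusterIn z y)
      ((finite_crossEdges _ _).union (finite_crossEdges _ _)) (finite_crossEdges _ _),
      measure_inter_of_dependsOn hdC hdE (finite_crossEdges _ _) (finite_crossEdges _ _),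
      ← percMeasure, mul_assoc]
    · gcongr
      · rw [hE]; exact measure_open_le hβ huz
      · exact connProb_mono Finset.sdiff_subset z y
    · refine disjoint_crossEdges ?_
      intro a ha b hb a' ha' b' hb'
      rw [Finset.mem_singleton] at ha' hb'
      subst ha' hb'
      exact ⟨fun h => hz.2 (h.2 ▸ hb), fun h => hz.2 (h.1 ▸ hc.1 ha)⟩
    · rw [Set.disjoint_union_left]
      constructor
      · refine disjoint_crossEdges ?_
        intro a ha b hb a' ha' b' hb'
        rw [Finset.mem_sdiff] at ha' hb'
        exact ⟨fun h => ha'.2 (h.1 ▸ ha), fun h => hb'.2 (h.1 ▸ ha)⟩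
      · refine disjoint_crossEdges ?_
        intro a ha b hb a' ha' b' hb'
        rw [Finset.mem_sdiff] at ha' hb'
        rw [Finset.mem_singleton] at ha hb
        subst ha hb
        exact ⟨fun h => ha'.2 (h.1 ▸ hc.2), fun h => hb'.2 (h.1 ▸ hc.2)⟩
  refine (Finset.sum_le_sum hterm).trans ?_
  rw [← Finset.sum_mul, mul_assoc]
  gcongr
  -- The events that the cluster equals `c` are disjoint, so summing over `c` containing `u`
  -- recovers the probability that `x` is connected to `u` in `B`.
  rw [← measure_biUnion_finset]
  · refine measure_mono ?_
    intro ω hω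
    simp only [Set.mem_iUnion] at hω
    obtain ⟨c, hc, hω⟩ := hω
    rw [Finset.mem_filter] at hc
    change u ∈ clusterIn B ω x
    rw [show clusterIn B ω x = c from hω]
    exact hc.2
  · intro c _ c' _ hcc'
    refine Set.disjoint_left.2 fun ω h h' => hcc' ?_
    exact (show clusterIn B ω x = c from h).symm.trans h'
  · intro c _
    exact measurableSet_of_dependsOn (dependsOn_clusterIn_eq x hx) (finite_crossEdges _ _)

end

/-! ### The finite-volume criterion for the susceptibility -/

section

variable {d L : ℕ} {α β : ℝ} [NeZero L]

/-- This is `connProb_le` summed over the endpoint `y`: the last factor becomes a mean size from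
`z`, the middle one a total rate out of the small block, and the first one a mean size in the small
block. -/
theorem meanSize_block_le {m n : ℕ} (hL : 2 ≤ L) (hα : 1 ≤ α) (hβ : 0 ≤ β) (h : n ≤ m)
    {s t : ℝ≥0∞} (hs : ∀ x : HLattice d L, meanSize α β (block n x) x ≤ s)
    (ht : ∀ x : HLattice d L, meanSize α β (block m x) x ≤ t) (x : HLattice d L) :
    meanSize α β (block m x) x ≤
      s + s * ENNReal.ofReal (β * ((L : ℝ) ^ (-α)) ^ n) * t := by
  have hsub := block_mono (x := x) h
  have h1 : ∑ y ∈ block m x, connProb α β (block n x) x y ≤ s := by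
    refine le_trans (le_of_eq ?_) (hs x)
    rw [meanSize_eq_sum]
    refine (Finset.sum_subset hsub fun y _ hy => ?_).symm
    rw [connProb, show {ω : Edge d L → Bool | y ∈ clusterIn (block n x) ω x} = ∅ from
      Set.eq_empty_of_forall_notMem fun ω hω => hy (clusterIn_subset hω), measure_empty]
  have h2 : ∀ u ∈ block n x, ∑ z ∈ block m x \ block n x, ENNReal.ofReal (β * rate α u z) ≤
      ENNReal.ofReal (β * ((L : ℝ) ^ (-α)) ^ n) := by
    intro u hu
    rw [← ENNReal.ofReal_sum_of_nonneg fun z _ => mul_nonneg hβ (rate_nonneg u z),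
      ← Finset.mul_sum, ← block_eq_of_mem hu, ← block_eq_of_mem (hsub hu)]
    exact ENNReal.ofReal_le_ofReal (mul_le_mul_of_nonneg_left (sum_rate_le hL hα h u) hβ)
  rw [meanSize_eq_sum]
  calc ∑ y ∈ block m x, connProb α β (block m x) x y
      ≤ ∑ y ∈ block m x, (connProb α β (block n x) x y +
          ∑ u ∈ block n x, ∑ z ∈ block m x \ block n x,
          connProb α β (block n x) x u * ENNReal.ofReal (β * rate α u z) *
            connProb α β (block m x) z y) :=
        Finset.sum_le_sum fun y _ => connProb_le hβ self_mem_block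
    _ = ∑ y ∈ block m x, connProb α β (block n x) x y +
          ∑ u ∈ block n x, ∑ z ∈ block m x \ block n x,
          connProb α β (block n x) x u * ENNReal.ofReal (β * rate α u z) *
            meanSize α β (block m z) z := by
        rw [Finset.sum_add_distrib, Finset.sum_comm]
        congr 1
        refine Finset.sum_congr rfl fun u _ => ?_
        rw [Finset.sum_comm]
        refine Finset.sum_congr rfl fun z hz => ?_
        rw [meanSize_eq_sum, block_eq_of_mem (Finset.mem_sdiff.1 hz).1, Finset.mul_sum]
    _ ≤ s + ∑ u ∈ block n x, ∑ z ∈ block m x \ block n x,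
          connProb α β (block n x) x u * ENNReal.ofReal (β * rate α u z) * t := by
        gcongr
        exact ht _
    _ = s + ∑ u ∈ block n x, connProb α β (block n x) x u *
          (∑ z ∈ block m x \ block n x, ENNReal.ofReal (β * rate α u z)) * t := by
        simp only [Finset.mul_sum, Finset.sum_mul]
    _ ≤ s + ∑ u ∈ block n x, connProb α β (block n x) x u *
          ENNReal.ofReal (β * ((L : ℝ) ^ (-α)) ^ n) * t := by
        gcongr with u hu
        exact h2 u hu
    _ ≤ _ := by
        rw [← Finset.sum_mul, ← Finset.sum_mul, ← meanSize_eq_sum]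
        gcongr
        exact hs x

/-- The supremum t over starting points satisfies t ≤ s + t/2. It is finite because the volume is,
so t/2 may be subtracted; the resulting bound does not depend on `m`. -/
theorem meanSize_le_two_mul {m n : ℕ} (hL : 2 ≤ L) (hα : 1 ≤ α) (hβ : 0 ≤ β) (h : n ≤ m)
    {s : ℝ≥0∞} (hs : ∀ x : HLattice d L, meanSize α β (block n x) x ≤ s)
    (hφ : s * ENNReal.ofReal (β * ((L : ℝ) ^ (-α)) ^ n) ≤ 2⁻¹) (x : HLattice d L) :
    meanSize α β (block m x) x ≤ 2 * s := by
  set t : ℝ≥0∞ := ⨆ x : HLattice d L, meanSize α β (block m x) x with ht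
  have htop : t ≠ ∞ := by
    refine ne_top_of_le_ne_top (ENNReal.natCast_ne_top ((L ^ d) ^ m)) (iSup_le fun x => ?_)
    rw [← card_block m x]
    exact meanSize_le_card x
  have ht2 : t ≤ s + 2⁻¹ * t := iSup_le fun x =>
    (meanSize_block_le hL hα hβ h hs (fun x => le_iSup (fun x => meanSize α β (block m x) x) x) x).trans (by gcongr)
  have h3 : 2⁻¹ * t + 2⁻¹ * t ≤ s + 2⁻¹ * t := by
    rwa [← add_mul, ENNReal.inv_two_add_inv_two, one_mul]
  have h4 : 2⁻¹ * t ≤ s :=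
    (ENNReal.add_le_add_iff_right (ENNReal.mul_ne_top (by simp) htop)).1 h3
  calc meanSize α β (block m x) x ≤ t := le_iSup (fun x => meanSize α β (block m x) x) x
    _ = 2 * (2⁻¹ * t) := by
        rw [← mul_assoc, ENNReal.mul_inv_cancel (by simp) (by simp), one_mul]
    _ ≤ 2 * s := by gcongr

theorem encard_cluster_eq_iSup (ω : Edge d L → Bool) (x : HLattice d L) :
    ((cluster ω x).encard : ℝ≥0∞) = ⨆ n, ((clusterIn (block n x) ω x).card : ℝ≥0∞) := by
  -- Cardinality is read as counting measure, so that continuity from below along the increasing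
  -- finite clusters applies.
  let _ : MeasurableSpace (HLattice d L) := ⊤
  have hmono : Monotone fun n => (clusterIn (block n x) ω x : Set (HLattice d L)) :=
    fun a b hab => Finset.coe_subset.2 (clusterIn_mono (block_mono hab))
  rw [cluster_eq_iUnion, ← Measure.count_apply MeasurableSpace.measurableSet_top, hmono.measure_iUnion]
  exact iSup_congr fun n => Measure.count_apply_finset' MeasurableSpace.measurableSet_top

theorem susceptibility_eq_iSup :
    susceptibility d L α β = ⨆ n, meanSize α β (block n 0) (0 : HLattice d L) := by
  simp only [susceptibility, encard_cluster_eq_iSup, meanSize]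
  refine lintegral_iSup (fun n => measurable_card_clusterIn 0) ?_
  intro a b hab ω
  exact Nat.cast_le.2 (Finset.card_le_card (clusterIn_mono (block_mono hab)))

theorem meanSize_le_susceptibility (n : ℕ) :
    meanSize α β (block n 0) (0 : HLattice d L) ≤ susceptibility d L α β := by
  rw [susceptibility_eq_iSup]
  exact le_iSup (fun n => meanSize α β (block n 0) (0 : HLattice d L)) n

theorem one_le_susceptibility : 1 ≤ susceptibility d L α β := by
  refine le_trans ?_ (meanSize_le_susceptibility 0)
  calc (1 : ℝ≥0∞) = ∫⁻ _, 1 ∂(percMeasure d L α β) := by simp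
    _ ≤ _ := lintegral_mono fun ω => by
      exact Nat.one_le_cast.2 (Finset.card_pos.2 ⟨0, self_mem_clusterIn self_mem_block⟩)

theorem susceptibility_le_two_mul {n : ℕ} (hL : 2 ≤ L) (hα : 1 ≤ α) (hβ : 0 ≤ β)
    {s : ℝ≥0∞} (hs : ∀ x : HLattice d L, meanSize α β (block n x) x ≤ s)
    (hφ : s * ENNReal.ofReal (β * ((L : ℝ) ^ (-α)) ^ n) ≤ 2⁻¹) :
    susceptibility d L α β ≤ 2 * s := by
  rw [susceptibility_eq_iSup]
  refine iSup_le fun m => ?_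
  refine le_trans ?_ (meanSize_le_two_mul hL hα hβ (le_max_right m n) hs hφ 0)
  exact lintegral_mono fun ω => Nat.cast_le.2
    (Finset.card_le_card (clusterIn_mono (block_mono (le_max_left m n))))

end

/-! ### Translation invariance -/

section

variable {d L : ℕ} {α β : ℝ}

/-- The translation by `v`, acting on edges. -/
noncomputable def shiftEdge (v : HLattice d L) (e : Edge d L) : Edge d L :=
  ⟨e.1.map (· + v), (Sym2.isDiag_map (add_left_injective v)).not.2 e.2⟩

theorem shiftEdge_injective (v : HLattice d L) : Function.Injective (shiftEdge v) :=
  fun _ _ h => Subtype.ext (Sym2.map.injective (add_left_injective v) (congrArg Subtype.val h))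

theorem hdist_add_right (x y v : HLattice d L) : hdist (x + v) (y + v) = hdist x y := by
  simp [hdist]

theorem edgeLength_shiftEdge (v : HLattice d L) (e : Edge d L) :
    edgeLength (shiftEdge v e) = edgeLength e := by
  obtain ⟨e, he⟩ := e
  induction e with
  | _ x y => exact hdist_add_right x y v

theorem edgeProb_shiftEdge (v : HLattice d L) (e : Edge d L) :
    edgeProb α β (shiftEdge v e) = edgeProb α β e := by
  simp only [edgeProb, edgeLength_shiftEdge]

/-- A translation permutes the factors of the product measure among edges of equal length, hence of
equal marginal. -/
theorem measurePreserving_shift (v : HLattice d L) :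
    MeasurePreserving (fun (ω : Edge d L → Bool) e => ω (shiftEdge v e))
      (percMeasure d L α β) (percMeasure d L α β) := by
  refine ⟨measurable_pi_lambda _ fun e => measurable_pi_apply _, ?_⟩
  have h := Measure.map_infinitePi_infinitePi_of_inj
    (P := fun e : Edge d L => bernoulliMeasure true false (edgeProb α β e))
    (shiftEdge_injective v)
  simp only [edgeProb_shiftEdge] at h
  exact h

theorem adj_shift (v : HLattice d L) (ω : Edge d L → Bool) (x y : HLattice d L) :
    (openGraph fun e => ω (shiftEdge v e)).Adj x y ↔ (openGraph ω).Adj (x + v) (y + v) := by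
  by_cases h : x = y
  · subst h; simp
  · rw [adj_iff h, adj_iff fun h' => h (add_right_cancel h')]
    rfl

theorem meanSize_block_eq [NeZero L] (n : ℕ) (v : HLattice d L) :
    meanSize α β (block n v) v = meanSize α β (block n 0) (0 : HLattice d L) := by
  rw [meanSize, meanSize, ← (measurePreserving_shift (α := α) (β := β) v).lintegral_comp
    (measurable_card_clusterIn 0)]
  refine lintegral_congr fun ω => ?_
  have hmem : ∀ y : HLattice d L, y + v ∈ block n v ↔ y ∈ block n 0 := fun y => by
    simp [mem_block]
  have hmem' : ∀ y : HLattice d L, y - v ∈ block n 0 ↔ y ∈ block n v := fun y => by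
    rw [← hmem, sub_add_cancel]
  refine congrArg _ (Finset.card_bij' (fun y _ => y - v) (fun y _ => y + v) ?_ ?_ ?_ ?_)
  · intro y hy
    refine clusterIn_induction (p := fun y => y - v ∈ clusterIn (block n 0)
      (fun e => ω (shiftEdge v e)) 0) ?_ ?_ hy
    · rw [sub_self]; exact self_mem_clusterIn self_mem_block
    · intro y _ z hz hy' hyz
      refine mem_clusterIn_of_adj hy' ?_ ((hmem' z).2 hz)
      rw [adj_shift, sub_add_cancel, sub_add_cancel]
      exact hyz
  · intro y hy
    refine clusterIn_induction (p := fun y => y + v ∈ clusterIn (block n v) ω v) ?_ ?_ hy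
    · rw [zero_add]; exact self_mem_clusterIn self_mem_block
    · intro y _ z hz hy' hyz
      exact mem_clusterIn_of_adj hy' ((adj_shift v ω y z).1 hyz) ((hmem z).2 hz)
  · intro y _; simp
  · intro y _; simp

end

/-! ### Connected blocks from below, block volume from above -/

section

variable {d L : ℕ} {α β : ℝ} [NeZero L] {Λ : Finset (HLattice d L)} {ω : Edge d L → Bool}
  {x y : HLattice d L}

/-- The sibling blocks around `x` and `y` are not joined by an edge. -/
def siblingGap (x y : HLattice d L) : Set (Edge d L → Bool) :=
  noEdge (block (level x y - 1) x) (block (level x y - 1) y)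

theorem disjoint_siblings (h : x ≠ y) :
    Disjoint (block (level x y - 1) x) (block (level x y - 1) y) := by
  refine disjoint_block fun h' => ?_
  have := mem_block_iff_level.1 h'
  have := level_pos h
  omega

theorem mul_le_sum_sum_rate {A B : Finset (HLattice d L)} {n : ℕ} (hα : 0 ≤ α) {z : HLattice d L}
    (hA : A ⊆ block n z) (hB : B ⊆ block n z) (hAB : Disjoint A B) :
    (A.card * B.card : ℝ) * ((L : ℝ) ^ n) ^ (-(d : ℝ) - α) ≤
      ∑ a ∈ A, ∑ b ∈ B, rate α a b := by
  calc (A.card * B.card : ℝ) * ((L : ℝ) ^ n) ^ (-(d : ℝ) - α)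
      = ∑ a ∈ A, ∑ b ∈ B, ((L : ℝ) ^ n) ^ (-(d : ℝ) - α) := by
        simp [mul_assoc]
    _ ≤ _ := Finset.sum_le_sum fun a ha => Finset.sum_le_sum fun b hb =>
        rate_ge_of_mem_block hα (by rw [block_eq_of_mem (hA ha)]; exact hB hb)
          (by rintro rfl; exact Finset.disjoint_left.1 hAB ha hb)

/-- Siblings inside a block of level k+1 have N^k points each, with pairwise rates at least
L^(-(d+α)(k+1)), so their total rate is at least L^(-(α-d)(k+1)) / N^2. As α ≥ d, the top level is
the worst. -/
theorem measure_siblingGap_le {n : ℕ} (hα : (d : ℝ) ≤ α) (hβ : 0 ≤ β) (h : x ≠ y)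
    (hn : level x y ≤ n) : percMeasure d L α β (siblingGap x y) ≤
      ENNReal.ofReal (Real.exp (-(β / ((L : ℝ) ^ d) ^ 2 * ((L : ℝ) ^ (-(α - d))) ^ n))) := by
  have hL : (1 : ℝ) ≤ L := by exact_mod_cast NeZero.one_le
  have hL0 : (0 : ℝ) < L := by linarith
  have hd : (0 : ℝ) ≤ d := by positivity
  rw [siblingGap, measure_noEdge hβ (disjoint_siblings h)]
  refine ENNReal.ofReal_le_ofReal (Real.exp_le_exp.2 (neg_le_neg ?_))
  rw [div_mul_eq_mul_div, mul_div_assoc]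
  refine mul_le_mul_of_nonneg_left ?_ hβ
  have hk := level_pos h
  refine le_trans ?_ (mul_le_sum_sum_rate (n := level x y) (z := x) (hd.trans hα)
    (block_mono (Nat.sub_le _ _)) ?_ (disjoint_siblings h))
  · rw [card_block, card_block]
    obtain ⟨k, hk⟩ : ∃ k, level x y = k + 1 := ⟨level x y - 1, by omega⟩
    rw [hk] at hn
    rw [hk, Nat.add_sub_cancel]
    have hq : (L : ℝ) ^ (-(α - d)) ≤ 1 := Real.rpow_le_one_of_one_le_of_nonpos hL (by linarith)
    calc ((L : ℝ) ^ (-(α - d))) ^ n / ((L : ℝ) ^ d) ^ 2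
        ≤ ((L : ℝ) ^ (-(α - d))) ^ (k + 1) / ((L : ℝ) ^ d) ^ 2 := by
          gcongr 1
          exact pow_le_pow_of_le_one (by positivity) hq hn
      _ = _ := by
          push_cast
          rw [div_eq_iff (by positivity)]
          simp only [← Real.rpow_natCast, ← Real.rpow_mul hL0.le, ← Real.rpow_add hL0]
          congr 1
          push_cast
          ring
  · have hy : y ∈ block (level x y) x := mem_block_iff_level.2 le_rfl
    rw [← block_eq_of_mem hy]
    exact block_mono (Nat.sub_le _ _)

theorem mem_clusterIn_of_no_gap {n : ℕ} {x₀ : HLattice d L}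
    (h : ∀ x ∈ block n x₀, ∀ y ∈ block n x₀, x ≠ y → ω ∉ siblingGap x y) (k : ℕ) :
    ∀ x ∈ block n x₀, ∀ y ∈ block n x₀, level x y ≤ k → y ∈ clusterIn (block n x₀) ω x := by
  induction k with
  | zero =>
    intro x hx y _ hxy
    by_cases hne : x = y
    · exact hne ▸ self_mem_clusterIn hx
    · have := level_pos hne
      omega
  | succ k ih =>
    intro x hx y hy hxy
    rcases Nat.lt_or_eq_of_le hxy with hlt | heq
    · exact ih x hx y hy (by omega)
    · have hne : x ≠ y := by
        rintro rfl
        have : level x x ≤ 0 := level_le_iff.2 fun _ _ => rfl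
        omega
      have hk : k ≤ n := by
        rw [← block_eq_of_mem hx, mem_block_iff_level] at hy
        omega
      have hgap := h x hx y hy hne
      rw [siblingGap, heq, Nat.add_sub_cancel, noEdge] at hgap
      simp only [Set.mem_ofPred_eq, not_forall, not_not] at hgap
      -- An open edge joins the sibling blocks of `x` and `y`. The induction hypothesis connects `x`
      -- to `u` and `v` to `y`, since these pairs lie at level at most `k`.
      obtain ⟨u, hu, v, hv, huv⟩ := hgap
      have hu' : u ∈ block n x₀ := by
        rw [← block_eq_of_mem hx]; exact block_mono hk hu
      have hv' : v ∈ block n x₀ := by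
        rw [← block_eq_of_mem hy]; exact block_mono hk hv
      have h1 := ih x hx u hu' (mem_block_iff_level.1 hu)
      have h2 := mem_clusterIn_of_adj h1 huv hv'
      have h3 := ih v hv' y hy (by rw [level_comm]; exact mem_block_iff_level.1 hv)
      rwa [clusterIn_eq_of_mem h2] at h3

/-- The hypothesis is a union bound over the N^(2n) ordered pairs of points: with probability at
least 1/2 no pair has a sibling gap, and then the cluster of 0 fills the block. -/
theorem le_susceptibility_of_connected {n : ℕ} (hα : (d : ℝ) ≤ α) (hβ : 0 ≤ β)
    (h : (((L : ℝ) ^ d) ^ n) ^ 2 *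
      Real.exp (-(β / ((L : ℝ) ^ d) ^ 2 * ((L : ℝ) ^ (-(α - d))) ^ n)) ≤ 1 / 2) :
    ENNReal.ofReal (((L : ℝ) ^ d) ^ n / 2) ≤ susceptibility d L α β := by
  classical
  refine le_trans ?_ (meanSize_le_susceptibility n)
  set p := Real.exp (-(β / ((L : ℝ) ^ d) ^ 2 * ((L : ℝ) ^ (-(α - d))) ^ n)) with hp
  set Λ := block n (0 : HLattice d L) with hΛ
  set bad : Set (Edge d L → Bool) := ⋃ q ∈ (Λ ×ˢ Λ).filter (fun q => q.1 ≠ q.2),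
    siblingGap q.1 q.2 with hbad
  have hm : MeasurableSet bad :=
    Finset.measurableSet_biUnion _ fun q _ => measurableSet_noEdge _ _
  have hbadP : percMeasure d L α β bad ≤ ENNReal.ofReal (1 / 2) := by
    refine (measure_biUnion_finset_le _ _).trans ?_
    calc ∑ q ∈ (Λ ×ˢ Λ).filter (fun q => q.1 ≠ q.2), percMeasure d L α β (siblingGap q.1 q.2)
        ≤ ∑ q ∈ (Λ ×ˢ Λ).filter (fun q => q.1 ≠ q.2), ENNReal.ofReal p := by
          refine Finset.sum_le_sum fun q hq => ?_
          simp only [Finset.mem_filter, Finset.mem_product] at hq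
          refine measure_siblingGap_le hα hβ hq.2 ?_
          rw [← mem_block_iff_level, block_eq_of_mem hq.1.1]
          exact hq.1.2
      _ ≤ ∑ q ∈ Λ ×ˢ Λ, ENNReal.ofReal p :=
          Finset.sum_le_sum_of_subset (Finset.filter_subset _ _)
      _ = ENNReal.ofReal ((((L : ℝ) ^ d) ^ n) ^ 2 * p) := by
          rw [Finset.sum_const, Finset.card_product, hΛ, card_block, nsmul_eq_mul,
            ENNReal.ofReal_mul (by positivity), ← ENNReal.ofReal_natCast]
          push_cast
          rw [sq]
      _ ≤ _ := ENNReal.ofReal_le_ofReal h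
  have hgood : ENNReal.ofReal (1 / 2) ≤ percMeasure d L α β badᶜ := by
    rw [prob_compl_eq_one_sub hm]
    refine ENNReal.le_sub_of_add_le_left (ne_top_of_le_ne_top ENNReal.ofReal_ne_top hbadP) ?_
    calc _ ≤ ENNReal.ofReal (1 / 2) + ENNReal.ofReal (1 / 2) := by gcongr
      _ = 1 := by rw [← ENNReal.ofReal_add (by norm_num) (by norm_num)]; norm_num
  calc ENNReal.ofReal (((L : ℝ) ^ d) ^ n / 2)
      = (Λ.card : ℝ≥0∞) * ENNReal.ofReal (1 / 2) := by
        rw [hΛ, card_block, ← ENNReal.ofReal_natCast, ← ENNReal.ofReal_mul (by positivity)]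
        push_cast
        congr 1
        ring
    _ ≤ (Λ.card : ℝ≥0∞) * percMeasure d L α β badᶜ := by gcongr
    _ = ∫⁻ ω, badᶜ.indicator (fun _ => (Λ.card : ℝ≥0∞)) ω ∂(percMeasure d L α β) := by
        rw [lintegral_indicator_const hm.compl]
    _ ≤ meanSize α β Λ 0 := by
        refine lintegral_mono fun ω => ?_
        by_cases hω : ω ∈ badᶜ
        · rw [Set.indicator_of_mem hω]
          refine Nat.cast_le.2 (Finset.card_le_card fun y hy => ?_)
          refine mem_clusterIn_of_no_gap ?_ (level 0 y) 0 self_mem_block y hy le_rfl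
          intro x hx y hy hne hgap
          refine hω (Set.mem_biUnion (x := (x, y)) ?_ hgap)
          exact Finset.mem_filter.2 ⟨Finset.mem_product.2 ⟨hx, hy⟩, hne⟩
        · rw [Set.indicator_of_notMem hω]
          exact bot_le

/-- The criterion with the trivial bound s = N^n, for which N^n L^(-αn) = L^(-(α-d)n). -/
theorem susceptibility_le_of_card {n : ℕ} (hL : 2 ≤ L) (hα : 1 ≤ α) (hβ : 0 ≤ β)
    (h : β * ((L : ℝ) ^ (-(α - d))) ^ n ≤ 1 / 2) :
    susceptibility d L α β ≤ ENNReal.ofReal (2 * ((L : ℝ) ^ d) ^ n) := by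
  have hL0 : (0 : ℝ) < L := by exact_mod_cast NeZero.pos L
  have hs : ∀ x : HLattice d L, meanSize α β (block n x) x ≤
      ENNReal.ofReal (((L : ℝ) ^ d) ^ n) := fun x => by
    refine (meanSize_le_card x).trans (le_of_eq ?_)
    rw [card_block, ← ENNReal.ofReal_natCast]
    push_cast
    rfl
  refine (susceptibility_le_two_mul hL hα hβ hs ?_).trans (le_of_eq ?_)
  · rw [← ENNReal.ofReal_mul (by positivity)]
    refine (ENNReal.ofReal_le_ofReal (le_trans (le_of_eq ?_) h)).trans (le_of_eq ?_)
    · rw [mul_left_comm, ← mul_pow]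
      congr 2
      rw [← Real.rpow_natCast, ← Real.rpow_add hL0]
      congr 1
      ring
    · rw [one_div, ENNReal.ofReal_inv_of_pos (by norm_num)]
      simp
  · rw [ENNReal.ofReal_mul (by norm_num)]
    simp

end

/-! ### The case α > d: polynomial growth -/

section

variable {d L : ℕ} {α β : ℝ} [NeZero L]

theorem susceptibility_le_rpow (hL : 2 ≤ L) (hα : 1 ≤ α) (hdα : (d : ℝ) < α) (hβ : 1 ≤ β) :
    susceptibility d L α β ≤
      ENNReal.ofReal (2 * (L : ℝ) ^ d * (2 * β) ^ ((d : ℝ) / (α - d))) := by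
  have hL' : (2 : ℝ) ≤ L := by exact_mod_cast hL
  have hL0 : (0 : ℝ) < L := by linarith
  have hγ : 0 < α - d := sub_pos.2 hdα
  have hlogL : 0 < Real.log L := Real.log_pos (by linarith)
  set γ := α - d with hγdef
  -- The real level at which β L^(-γt) = 1/2 exactly; rounding up costs at most one factor L^d.
  set t : ℝ := Real.log (2 * β) / (γ * Real.log L) with ht
  have ht0 : 0 ≤ t := div_nonneg (Real.log_nonneg (by linarith)) (by positivity)
  have hLt : ∀ s : ℝ, (L : ℝ) ^ (t * s) = (2 * β) ^ (s / γ) := by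
    intro s
    rw [Real.rpow_def_of_pos hL0, Real.rpow_def_of_pos (by linarith)]
    congr 1
    rw [ht]
    field_simp
  set n := ⌈t⌉₊ with hn
  have hn1 : t ≤ n := Nat.le_ceil t
  have hn2 : (n : ℝ) ≤ t + 1 := (Nat.ceil_lt_add_one ht0).le
  refine (susceptibility_le_of_card (n := n) hL hα (by linarith) ?_).trans
    (ENNReal.ofReal_le_ofReal ?_)
  · rw [← Real.rpow_natCast, ← Real.rpow_mul hL0.le]
    calc β * (L : ℝ) ^ (-γ * n) ≤ β * (L : ℝ) ^ (t * (-γ)) := by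
          refine mul_le_mul_of_nonneg_left
            (Real.rpow_le_rpow_of_exponent_le (by linarith) (by nlinarith)) (by linarith)
      _ = 1 / 2 := by
          rw [hLt, neg_div, div_self hγ.ne', Real.rpow_neg_one]
          field_simp
  · rw [mul_assoc]
    gcongr
    rw [← Real.rpow_natCast, ← Real.rpow_natCast, ← Real.rpow_mul hL0.le, ← hLt,
      ← Real.rpow_add hL0]
    refine Real.rpow_le_rpow_of_exponent_le (by linarith) ?_
    nlinarith [(Nat.cast_nonneg d : (0 : ℝ) ≤ d)]

theorem exists_rpow_le_susceptibility (hL : 2 ≤ L) (hdα : (d : ℝ) < α) :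
    ∀ᶠ β : ℝ in atTop, ENNReal.ofReal
      ((β / (Real.log β) ^ 2) ^ ((d : ℝ) / (α - d)) / (2 * (L : ℝ) ^ d)) ≤
        susceptibility d L α β := by
  have hL' : (2 : ℝ) ≤ L := by exact_mod_cast hL
  have hL0 : (0 : ℝ) < L := by linarith
  have hγ : 0 < α - d := sub_pos.2 hdα
  have hlogL : 0 < Real.log L := Real.log_pos (by linarith)
  have hd0 : (0 : ℝ) ≤ d := Nat.cast_nonneg d
  set γ := α - d with hγdef
  set p := (d : ℝ) / γ with hp
  have hp0 : 0 ≤ p := by positivity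
  set c : ℝ := 1 / ((L : ℝ) ^ d) ^ 2 with hc
  have hc0 : 0 < c := by positivity
  have hlog : Tendsto Real.log atTop atTop := Real.tendsto_log_atTop
  have hratio : ∀ᶠ β : ℝ in atTop, (Real.log β) ^ 2 ≤ β := by
    filter_upwards [(Real.isLittleO_pow_log_id_atTop (n := 2)).bound one_pos,
      eventually_ge_atTop 1] with β h1 h2
    simpa [abs_of_nonneg (zero_le_one.trans h2)] using h1
  filter_upwards [hratio, hlog.eventually_ge_atTop 1, eventually_ge_atTop 1,
    hlog.eventually_ge_atTop ((2 * p + 1) / c)] with β h1 h2 h3 h4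
  set l := Real.log β with hl
  have hβ0 : 0 < β := by linarith
  -- With L^(γt) = b and `n` the integer part of t, β L^(-γn) is at least l^2 = (log β)^2. The
  -- exponent -c l^2 then beats the 2 p l coming from the number of pairs as soon as c l ≥ 2p + 1
  -- and l ≥ 1.
  set b := β / l ^ 2 with hb
  have hb1 : 1 ≤ b := (one_le_div (by positivity)).2 h1
  set t : ℝ := Real.log b / (γ * Real.log L) with ht
  have ht0 : 0 ≤ t := div_nonneg (Real.log_nonneg hb1) (by positivity)
  have hLt : ∀ s : ℝ, (L : ℝ) ^ (t * s) = b ^ (s / γ) := by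
    intro s
    rw [Real.rpow_def_of_pos hL0, Real.rpow_def_of_pos (by linarith)]
    congr 1
    rw [ht]
    field_simp
  set n := ⌊t⌋₊ with hn
  have hn1 : (n : ℝ) ≤ t := Nat.floor_le ht0
  have hn2 : t - 1 ≤ n := by linarith [Nat.lt_floor_add_one t]
  have hN : (((L : ℝ) ^ d) ^ n) ≤ b ^ p := by
    rw [← Real.rpow_natCast, ← Real.rpow_natCast, ← Real.rpow_mul hL0.le, hp, ← hLt]
    exact Real.rpow_le_rpow_of_exponent_le (by linarith) (by nlinarith)
  refine le_trans (ENNReal.ofReal_le_ofReal ?_)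
    (le_susceptibility_of_connected (n := n) hdα.le hβ0.le ?_)
  · have hN' : b ^ p ≤ (L : ℝ) ^ d * ((L : ℝ) ^ d) ^ n := by
      rw [← Real.rpow_natCast, ← Real.rpow_natCast, ← Real.rpow_mul hL0.le, hp, ← hLt,
        ← Real.rpow_add hL0]
      exact Real.rpow_le_rpow_of_exponent_le (by linarith) (by nlinarith)
    rw [div_le_div_iff₀ (by positivity) (by norm_num)]
    linarith
  · have hexp : l ^ 2 ≤ β * ((L : ℝ) ^ (-γ)) ^ n := by
      rw [← Real.rpow_natCast _ n, ← Real.rpow_mul hL0.le]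
      calc l ^ 2 = β * (L : ℝ) ^ (t * (-γ)) := by
            rw [hLt, neg_div, div_self hγ.ne', Real.rpow_neg_one, hb]
            field_simp
        _ ≤ _ := by
            exact mul_le_mul_of_nonneg_left
              (Real.rpow_le_rpow_of_exponent_le (by linarith) (by nlinarith)) hβ0.le
    have hN2 : (((L : ℝ) ^ d) ^ n) ^ 2 ≤ Real.exp (2 * p * l) := by
      calc (((L : ℝ) ^ d) ^ n) ^ 2 ≤ (b ^ p) ^ 2 := by gcongr
        _ ≤ (β ^ p) ^ 2 := by
            gcongr
            exact div_le_self hβ0.le (by nlinarith)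
        _ = Real.exp (2 * p * l) := by
            rw [Real.rpow_def_of_pos hβ0, ← Real.exp_nat_mul]
            congr 1
            push_cast
            ring
    calc _ ≤ Real.exp (2 * p * l) * Real.exp (-(c * l ^ 2)) := by
          refine mul_le_mul hN2 (Real.exp_le_exp.2 (neg_le_neg ?_)) (Real.exp_nonneg _)
            (Real.exp_nonneg _)
          rw [hc, div_mul_eq_mul_div, div_mul_eq_mul_div, one_mul]
          exact div_le_div_of_nonneg_right hexp (by positivity)
      _ = Real.exp (2 * p * l - c * l ^ 2) := by rw [← Real.exp_add]; rfl
      _ ≤ Real.exp (-1) := by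
          gcongr
          rw [div_le_iff₀ hc0] at h4
          nlinarith
      _ ≤ 1 / 2 := by
          rw [Real.exp_neg, one_div]
          refine inv_anti₀ (by norm_num) ?_
          linarith [Real.add_one_le_exp (1 : ℝ)]

theorem susceptibility_asymptotics (hd : 1 ≤ d) (hL : 2 ≤ L) (hdα : (d : ℝ) < α) :
    ∃ ε : ℝ → ℝ, Tendsto ε atTop (𝓝 0) ∧ ∀ᶠ β : ℝ in atTop,
      susceptibility d L α β = ENNReal.ofReal (β ^ ((d : ℝ) / (α - d) - ε β)) := by
  have hd1 : (1 : ℝ) ≤ d := by exact_mod_cast hd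
  have hL0 : (0 : ℝ) < L := by exact_mod_cast NeZero.pos L
  set p := (d : ℝ) / (α - d) with hp
  set χ : ℝ → ℝ := fun β => (susceptibility d L α β).toReal with hχ
  have hlog : Tendsto Real.log atTop atTop := Real.tendsto_log_atTop
  have hinv : Tendsto (fun β => (Real.log β)⁻¹) atTop (𝓝 0) := tendsto_inv_atTop_zero.comp hlog
  have hll : Tendsto (fun β => Real.log (Real.log β) / Real.log β) atTop (𝓝 0) :=
    (Real.isLittleO_log_id_atTop.tendsto_div_nhds_zero).comp hlog
  have hfin : ∀ β, 1 ≤ β → susceptibility d L α β ≠ ∞ := fun β hβ =>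
    ne_top_of_le_ne_top ENNReal.ofReal_ne_top
      (susceptibility_le_rpow hL (by linarith) hdα hβ)
  have hpos : ∀ β, 1 ≤ β → 1 ≤ χ β := fun β hβ => by
    have := ENNReal.toReal_mono (hfin β hβ) (one_le_susceptibility (d := d) (L := L) (α := α))
    simpa using this
  -- The choice of ε makes the identity hold by definition whenever β > 1. Only log χ / log β → p
  -- needs proof, by squeezing.
  refine ⟨fun β => p - Real.log (χ β) / Real.log β, ?_, ?_⟩
  · have key : Tendsto (fun β => Real.log (χ β) / Real.log β) atTop (𝓝 p) := by
      have hlow : Tendsto (fun β => p * (1 - 2 * (Real.log (Real.log β) / Real.log β)) -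
          Real.log (2 * (L : ℝ) ^ d) * (Real.log β)⁻¹) atTop (𝓝 p) := by
        simpa using ((((hll.const_mul 2).const_sub 1).const_mul p).sub
          (hinv.const_mul (Real.log (2 * (L : ℝ) ^ d))))
      have hupp : Tendsto (fun β => (Real.log (2 * (L : ℝ) ^ d) + p * Real.log 2) *
          (Real.log β)⁻¹ + p) atTop (𝓝 p) := by
        simpa using (hinv.const_mul (Real.log (2 * (L : ℝ) ^ d) + p * Real.log 2)).add_const p
      refine tendsto_of_tendsto_of_tendsto_of_le_of_le' hlow hupp ?_ ?_
      · filter_upwards [exists_rpow_le_susceptibility hL hdα, eventually_ge_atTop 1,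
          hlog.eventually_ge_atTop 1] with β h1 h2 h3
        have hβ0 : 0 < β := by linarith
        have hl0 : 0 < Real.log β := by linarith
        have h4 := (ENNReal.ofReal_le_iff_le_toReal (hfin β h2)).1 h1
        have h5 := Real.log_le_log (by positivity) h4
        rw [Real.log_div (by positivity) (by positivity), Real.log_rpow (by positivity),
          Real.log_div (by positivity) (by positivity), Real.log_pow, ← hp] at h5
        rw [le_div_iff₀ hl0]
        refine le_trans (le_of_eq ?_) h5
        push_cast
        field_simp
      · filter_upwards [eventually_ge_atTop 1, hlog.eventually_ge_atTop 1] with β h2 h3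
        have hβ0 : 0 < β := by linarith
        have hl0 : 0 < Real.log β := by linarith
        have h4 := ENNReal.toReal_le_of_le_ofReal (by positivity)
          (susceptibility_le_rpow hL (by linarith) hdα h2)
        have h5 := Real.log_le_log (by linarith [hpos β h2]) h4
        rw [Real.log_mul (by positivity) (by positivity), Real.log_rpow (by positivity),
          Real.log_mul two_ne_zero hβ0.ne', ← hp] at h5
        rw [div_le_iff₀ hl0]
        refine h5.trans (le_of_eq ?_)
        field_simp
        ring
    simpa using key.const_sub p
  · filter_upwards [eventually_gt_atTop 1] with β hβ
    have hl0 : 0 < Real.log β := Real.log_pos hβ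
    rw [sub_sub_cancel, Real.rpow_def_of_pos (by linarith), mul_div_cancel₀ _ hl0.ne',
      Real.exp_log (by linarith [hpos β hβ.le]), hχ, ENNReal.ofReal_toReal (hfin β hβ.le)]

end

/-! ### The case α = d: upper bound through isolated scales -/

section

theorem rpow_neg_natCast_eq {d L : ℕ} (hL0 : (0 : ℝ) ≤ L) : (L : ℝ) ^ (-(d : ℝ)) = ((L : ℝ) ^ d)⁻¹ := by
  rw [Real.rpow_neg hL0, Real.rpow_natCast]

variable {d L : ℕ} {α β : ℝ} [NeZero L] {ω : Edge d L → Bool} {x : HLattice d L}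

theorem sum_sum_rate_le {j n m : ℕ} (hL : 2 ≤ L) (hα : 1 ≤ α) (hj : j ≤ n) (h : n ≤ m)
    (x : HLattice d L) : ∑ a ∈ block j x, ∑ b ∈ block m x \ block n x, rate α a b ≤
      ((L : ℝ) ^ d) ^ j * ((L : ℝ) ^ (-α)) ^ n := by
  calc _ ≤ ∑ a ∈ block j x, ((L : ℝ) ^ (-α)) ^ n := by
        refine Finset.sum_le_sum fun a ha => ?_
        rw [← block_eq_of_mem (block_mono hj ha), ← block_eq_of_mem (block_mono (hj.trans h) ha)]
        exact sum_rate_le hL hα h a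
    _ = _ := by
        rw [Finset.sum_const, card_block, nsmul_eq_mul]
        push_cast
        rfl

/-- The block of level `j` around `x` is not joined to the annulus between levels `n` and `m`. -/
def annulusGap (j n m : ℕ) (x : HLattice d L) : Set (Edge d L → Bool) :=
  noEdge (block j x) (block m x \ block n x)

theorem disjoint_annulus {j n m : ℕ} (hj : j ≤ n) (x : HLattice d L) :
    Disjoint (block j x) (block m x \ block n x) :=
  Finset.disjoint_sdiff.mono_left (block_mono hj)

/-- Used in two regimes: for j = n it gives 1 - e^(-β), uniformly in the scale; for n = j + s it
gives at most β N^(-s), which controls jumps over an annulus. -/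
theorem measure_compl_annulusGap_le {j n m : ℕ} (hL : 2 ≤ L) (hd : 1 ≤ d) (hβ : 0 ≤ β)
    (hj : j ≤ n) (h : n ≤ m) (x : HLattice d L) :
    percMeasure d L d β (annulusGap j n m x)ᶜ ≤
      ENNReal.ofReal (1 - Real.exp (-(β * (((L : ℝ) ^ d) ^ j / ((L : ℝ) ^ d) ^ n)))) := by
  rw [annulusGap, prob_compl_eq_one_sub (measurableSet_noEdge _ _),
    measure_noEdge hβ (disjoint_annulus hj x), ← ENNReal.ofReal_one,
    ← ENNReal.ofReal_sub _ (Real.exp_nonneg _)]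
  have := sum_sum_rate_le hL (by exact_mod_cast hd : (1 : ℝ) ≤ d) hj h x
  rw [rpow_neg_natCast_eq (by positivity), inv_pow, ← div_eq_mul_inv] at this
  gcongr

theorem clusterIn_subset_of_annulusGap {j n m : ℕ} (h1 : ω ∈ annulusGap j j n x)
    (h2 : ω ∈ annulusGap j n m x) : clusterIn (block m x) ω x ⊆ block j x := by
  intro y hy
  refine clusterIn_induction (p := fun y => y ∈ block j x) self_mem_block ?_ hy
  intro u _ v hv hu huv
  by_contra hvj
  by_cases hvn : v ∈ block n x
  · exact h1 u hu v (Finset.mem_sdiff.2 ⟨hvn, hvj⟩) huv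
  · exact h2 u hu v (Finset.mem_sdiff.2 ⟨hv, hvn⟩) huv

/-- None of the blocks of levels `0, s, ..., s (k - 1)` is isolated from the next one. -/
def noIsolated (s k : ℕ) (x : HLattice d L) : Set (Edge d L → Bool) :=
  {ω | ∀ i < k, ω ∈ (annulusGap (s * i) (s * i) (s * (i + 1)) x)ᶜ}

theorem dependsOn_noIsolated (s k : ℕ) (x : HLattice d L) :
    DependsOn (fun ω => ω ∈ noIsolated s k x) (edgesIn (block (s * k) x)) := by
  intro ω ω' h
  refine propext (forall₂_congr fun i hi => not_congr ?_)
  refine iff_of_eq (dependsOn_noEdge _ _ fun e he => h e ?_)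
  obtain ⟨a, ha, b, hb, he⟩ := he
  exact ⟨a, block_mono (Nat.mul_le_mul_left s hi.le) ha, b,
    block_mono (Nat.mul_le_mul_left s hi) (Finset.mem_sdiff.1 hb).1, he⟩

/-- The events at earlier scales live on edges inside the level-sk block, the new one on edges
leaving it, so the probabilities multiply. -/
theorem measure_noIsolated_le (hL : 2 ≤ L) (hd : 1 ≤ d) (hβ : 0 ≤ β) (s k : ℕ)
    (x : HLattice d L) : percMeasure d L d β (noIsolated s k x) ≤
      ENNReal.ofReal ((1 - Real.exp (-β)) ^ k) := by
  have h0 : 0 ≤ 1 - Real.exp (-β) := by simpa using hβ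
  induction k with
  | zero => simpa using prob_le_one
  | succ k ih =>
    have hsplit : noIsolated s (k + 1) x =
        noIsolated s k x ∩ (annulusGap (s * k) (s * k) (s * (k + 1)) x)ᶜ := by
      ext ω
      constructor
      · exact fun h => ⟨fun i hi => h i (by omega), h k (by omega)⟩
      · rintro ⟨h1, h2⟩ i hi
        rcases Nat.lt_succ_iff_lt_or_eq.1 hi with h | rfl
        · exact h1 i h
        · exact h2
    have hdep : DependsOn (fun ω => ω ∈ (annulusGap (s * k) (s * k) (s * (k + 1)) x)ᶜ)
        (crossEdges (block (s * k) x) (block (s * (k + 1)) x \ block (s * k) x)) :=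
      fun ω ω' h => congrArg Not (dependsOn_noEdge _ _ h)
    rw [hsplit, percMeasure, measure_inter_of_dependsOn (dependsOn_noIsolated s k x) hdep
      (finite_crossEdges _ _) (finite_crossEdges _ _), ← percMeasure, pow_succ,
      ENNReal.ofReal_mul (pow_nonneg h0 k)]
    · refine mul_le_mul' ih ((measure_compl_annulusGap_le hL hd hβ le_rfl
        (Nat.mul_le_mul_left s (Nat.le_succ k)) x).trans ?_)
      rw [div_self (by positivity), mul_one]
    · refine disjoint_crossEdges fun a ha b hb a' _ b' hb' => ?_
      rw [Finset.mem_sdiff] at hb'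
      exact ⟨fun h => hb'.2 (h.2 ▸ hb), fun h => hb'.2 (h.1 ▸ ha)⟩

theorem meanSize_le_of_scales (hL : 2 ≤ L) (hd : 1 ≤ d) (hβ : 0 ≤ β) (s M : ℕ)
    (x : HLattice d L) : meanSize d β (block (s * M) x) x ≤
      ENNReal.ofReal (((L : ℝ) ^ d) ^ (s * M) * ((((L : ℝ) ^ d) ^ s)⁻¹ +
        (1 - Real.exp (-β)) ^ M + M * (β * (((L : ℝ) ^ d) ^ s)⁻¹))) := by
  have h0 : 0 ≤ 1 - Real.exp (-β) := by simpa using hβ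
  have hL0 : (0 : ℝ) < L := by exact_mod_cast NeZero.pos L
  set N : ℝ := (L : ℝ) ^ d with hN
  have hN0 : 0 < N := by positivity
  set far : Set (Edge d L → Bool) :=
    ⋃ i ∈ Finset.range M, (annulusGap (s * i) (s * (i + 1)) (s * M) x)ᶜ with hfar
  -- Off `E` some block of level si with i < M is joined neither to the next annulus nor beyond it.
  -- It contains the whole cluster and has at most N^(sM) / N^s points. On `E` the volume is the
  -- bound.
  set E := noIsolated s M x ∪ far with hE
  have hEm : MeasurableSet E :=
    (measurableSet_of_dependsOn (dependsOn_noIsolated s M x) (finite_crossEdges _ _)).union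
      (Finset.measurableSet_biUnion _ fun i _ => (measurableSet_noEdge _ _).compl)
  have hfarP : percMeasure d L d β far ≤ ENNReal.ofReal (M * (β * (N ^ s)⁻¹)) := by
    calc percMeasure d L d β far
        ≤ ∑ i ∈ Finset.range M,
          percMeasure d L d β (annulusGap (s * i) (s * (i + 1)) (s * M) x)ᶜ :=
          measure_biUnion_finset_le _ _
      _ ≤ ∑ i ∈ Finset.range M, ENNReal.ofReal (β * (N ^ s)⁻¹) := by
          refine Finset.sum_le_sum fun i hi => ?_
          refine (measure_compl_annulusGap_le hL hd hβ (Nat.mul_le_mul_left s (Nat.le_succ i))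
            (Nat.mul_le_mul_left s (Finset.mem_range.1 hi)) x).trans
            (ENNReal.ofReal_le_ofReal ?_)
          rw [← hN, Nat.mul_succ, pow_add, div_mul_cancel_left₀ (by positivity)]
          linarith [Real.add_one_le_exp (-(β * (N ^ s)⁻¹))]
      _ = _ := by
          rw [Finset.sum_const, Finset.card_range, nsmul_eq_mul,
            ENNReal.ofReal_mul (Nat.cast_nonneg M), ENNReal.ofReal_natCast]
  have hEP : percMeasure d L d β E ≤
      ENNReal.ofReal ((1 - Real.exp (-β)) ^ M + M * (β * (N ^ s)⁻¹)) := by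
    rw [ENNReal.ofReal_add (by positivity) (by positivity)]
    exact (measure_union_le _ _).trans
      (add_le_add (measure_noIsolated_le hL hd hβ s M x) hfarP)
  have hcard : ∀ n : ℕ, ((block n x).card : ℝ≥0∞) = ENNReal.ofReal (N ^ n) := fun n => by
    rw [card_block, ← ENNReal.ofReal_natCast]
    push_cast
    rfl
  have hpt : ∀ ω, ((clusterIn (block (s * M) x) ω x).card : ℝ≥0∞) ≤
      ENNReal.ofReal (N ^ (s * M) * (N ^ s)⁻¹) +
        E.indicator (fun _ => ENNReal.ofReal (N ^ (s * M))) ω := by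
    intro ω
    by_cases hω : ω ∈ E
    · rw [Set.indicator_of_mem hω, ← hcard]
      exact le_add_left (Nat.cast_le.2 (Finset.card_le_card clusterIn_subset))
    · rw [Set.indicator_of_notMem hω, add_zero]
      simp only [hE, hfar, Set.mem_union, not_or, Set.mem_iUnion, noIsolated,
        Set.mem_ofPred_eq, not_forall, not_exists, Set.mem_compl_iff, not_not] at hω
      obtain ⟨⟨i, hi, h1⟩, h2⟩ := hω
      have hsub := clusterIn_subset_of_annulusGap h1 (h2 i (Finset.mem_range.2 hi))
      have hle : s * i + s ≤ s * M := by
        rw [← Nat.mul_succ]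
        exact Nat.mul_le_mul_left s hi
      refine (Nat.cast_le.2 (Finset.card_le_card hsub)).trans ?_
      rw [hcard]
      refine ENNReal.ofReal_le_ofReal ?_
      rw [← div_eq_mul_inv, le_div_iff₀ (by positivity), ← pow_add]
      refine pow_le_pow_right₀ ?_ hle
      rw [hN]
      exact one_le_pow₀ (by exact_mod_cast NeZero.one_le)
  calc meanSize d β (block (s * M) x) x
      ≤ ∫⁻ ω, (ENNReal.ofReal (N ^ (s * M) * (N ^ s)⁻¹) +
        E.indicator (fun _ => ENNReal.ofReal (N ^ (s * M))) ω) ∂(percMeasure d L d β) :=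
        lintegral_mono hpt
    _ = ENNReal.ofReal (N ^ (s * M) * (N ^ s)⁻¹) +
        ENNReal.ofReal (N ^ (s * M)) * percMeasure d L d β E := by
        rw [lintegral_add_left measurable_const, lintegral_indicator_const hEm]
        simp
    _ ≤ ENNReal.ofReal (N ^ (s * M) * (N ^ s)⁻¹) + ENNReal.ofReal (N ^ (s * M)) *
        ENNReal.ofReal ((1 - Real.exp (-β)) ^ M + M * (β * (N ^ s)⁻¹)) := by gcongr
    _ = _ := by
        rw [← ENNReal.ofReal_mul (by positivity),
          ← ENNReal.ofReal_add (by positivity) (by positivity)]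
        congr 1
        ring

theorem susceptibility_le_of_scales (hL : 2 ≤ L) (hd : 1 ≤ d) (hβ : 1 ≤ β) (s M : ℕ)
    (h : β * ((((L : ℝ) ^ d) ^ s)⁻¹ + (1 - Real.exp (-β)) ^ M +
      M * (β * (((L : ℝ) ^ d) ^ s)⁻¹)) ≤ 1 / 2) :
    susceptibility d L d β ≤ ENNReal.ofReal (((L : ℝ) ^ d) ^ (s * M)) := by
  have hL0 : (0 : ℝ) < L := by exact_mod_cast NeZero.pos L
  have h0 : 0 ≤ 1 - Real.exp (-β) := by
    rw [sub_nonneg, Real.exp_le_one_iff]; linarith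
  have hb0 : 0 ≤ β := by linarith
  have key := susceptibility_le_two_mul (β := β) hL (by exact_mod_cast hd : (1 : ℝ) ≤ d) hb0
    (fun x => meanSize_le_of_scales hL hd hb0 s M x) ?_
  · refine key.trans ?_
    set δ := (((L : ℝ) ^ d) ^ s)⁻¹ + (1 - Real.exp (-β)) ^ M +
      M * (β * (((L : ℝ) ^ d) ^ s)⁻¹) with hδ
    have hδ0 : 0 ≤ δ := by positivity
    rw [show (2 : ℝ≥0∞) = ENNReal.ofReal 2 by simp, ← ENNReal.ofReal_mul (by norm_num)]
    refine ENNReal.ofReal_le_ofReal ?_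
    have : 0 < ((L : ℝ) ^ d) ^ (s * M) := by positivity
    have h1 : δ ≤ 1 / 2 := by nlinarith
    nlinarith
  · rw [← ENNReal.ofReal_mul (by positivity)]
    refine (ENNReal.ofReal_le_ofReal (le_trans (le_of_eq ?_) h)).trans (le_of_eq ?_)
    · rw [rpow_neg_natCast_eq hL0.le, inv_pow, mul_left_comm, mul_right_comm,
        mul_inv_cancel₀ (by positivity), one_mul]
    · rw [one_div, ENNReal.ofReal_inv_of_pos (by norm_num)]
      simp

theorem susceptibility_le_exp_exp (hL : 2 ≤ L) (hd : 1 ≤ d) :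
    ∀ᶠ β : ℝ in atTop,
      susceptibility d L d β ≤ ENNReal.ofReal (Real.exp (Real.exp (4 * β))) := by
  have hL0 : (2 : ℝ) ≤ L := by exact_mod_cast hL
  set N : ℝ := (L : ℝ) ^ d with hN
  have hN2 : 2 ≤ N := by
    calc (2 : ℝ) ≤ L := hL0
      _ = (L : ℝ) ^ 1 := (pow_one _).symm
      _ ≤ N := pow_le_pow_right₀ (by linarith) hd
  have hsmall : ∀ᶠ β : ℝ in atTop, β * Real.exp (-β) ≤ 1 / 8 := by
    have h := Real.tendsto_pow_mul_exp_neg_atTop_nhds_zero 1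
    simp only [pow_one] at h
    exact h.eventually (eventually_le_nhds (by norm_num))
  filter_upwards [hsmall, eventually_ge_atTop 1, eventually_ge_atTop (11 * Real.log N),
    eventually_ge_atTop 5] with β h1 h2 h3 h4
  -- 10 log 2 > 6 gives N^(-s) ≤ e^(-6β). The choice of `M` gives (1 - e^(-β))^M ≤ exp(-M e^(-β)) ≤
  -- e^(-β), while M ≤ e^(2β) keeps the sum over jumps small. Each of the three terms, times β, is
  -- then at most 1/8.
  set s := ⌈10 * β⌉₊ with hs
  set M := ⌈β * Real.exp β⌉₊ with hM
  have hs1 : 10 * β ≤ s := Nat.le_ceil _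
  have hs2 : (s : ℝ) ≤ 10 * β + 1 := (Nat.ceil_lt_add_one (by positivity)).le
  have hM1 : β * Real.exp β ≤ M := Nat.le_ceil _
  have he1 : β + 1 ≤ Real.exp β := Real.add_one_le_exp β
  have hE2 : Real.exp (2 * β) = Real.exp β ^ 2 := by
    rw [← Real.exp_nat_mul]; norm_num
  have hM2 : (M : ℝ) ≤ Real.exp (2 * β) := by
    have : (M : ℝ) ≤ β * Real.exp β + 1 := (Nat.ceil_lt_add_one (by positivity)).le
    rw [hE2]
    nlinarith
  have hNs : (N ^ s)⁻¹ ≤ Real.exp (-β) ^ 6 := by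
    have hl : (0.69 : ℝ) ≤ Real.log N :=
      (by linarith [Real.log_two_gt_d9] : (0.69 : ℝ) ≤ Real.log 2).trans
        (Real.log_le_log (by norm_num) hN2)
    rw [← Real.exp_nat_mul, ← Real.exp_log (by positivity : 0 < N), ← Real.exp_nat_mul,
      ← Real.exp_neg]
    gcongr
    push_cast
    nlinarith
  have hq : (1 - Real.exp (-β)) ^ M ≤ Real.exp (-β) := by
    calc (1 - Real.exp (-β)) ^ M ≤ Real.exp (-Real.exp (-β)) ^ M := by
          have : 0 ≤ 1 - Real.exp (-β) := by
            rw [sub_nonneg, Real.exp_le_one_iff]; linarith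
          gcongr
          linarith [Real.add_one_le_exp (-Real.exp (-β))]
      _ = Real.exp (-(M * Real.exp (-β))) := by
          rw [← Real.exp_nat_mul]; congr 1; ring
      _ ≤ Real.exp (-β) := by
          gcongr
          calc β = β * Real.exp β * Real.exp (-β) := by
                rw [mul_assoc, ← Real.exp_add]; simp
            _ ≤ _ := by gcongr
  refine (susceptibility_le_of_scales hL hd h2 s M ?_).trans (ENNReal.ofReal_le_ofReal ?_)
  · rw [← hN]
    set e := Real.exp (-β) with he
    have he0 : 0 < e := Real.exp_pos _
    have he1' : e ≤ 1 := Real.exp_le_one_iff.2 (by linarith)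
    have hMe : M * e ^ 2 ≤ 1 := by
      calc M * e ^ 2 ≤ Real.exp (2 * β) * e ^ 2 := by gcongr
        _ = 1 := by rw [he, ← Real.exp_nat_mul, ← Real.exp_add]; simp
    have hβe : 0 ≤ β * e := by positivity
    have t1 : β * (N ^ s)⁻¹ ≤ 1 / 8 := by
      calc β * (N ^ s)⁻¹ ≤ β * e ^ 6 := by gcongr
        _ = β * e * e ^ 5 := by ring
        _ ≤ 1 / 8 * 1 := mul_le_mul h1 (pow_le_one₀ he0.le he1') (by positivity) (by norm_num)
        _ = 1 / 8 := mul_one _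
    have t2 : β * (1 - e) ^ M ≤ 1 / 8 := le_trans (by gcongr) h1
    have t3 : β * (M * (β * (N ^ s)⁻¹)) ≤ 1 / 8 := by
      calc β * (M * (β * (N ^ s)⁻¹)) ≤ β * (M * (β * e ^ 6)) := by gcongr
        _ = (β * e) * ((β * e) * ((M * e ^ 2) * e ^ 2)) := by ring
        _ ≤ 1 / 8 * (1 / 8 * (1 * 1)) := by
            gcongr
            exact pow_le_one₀ he0.le he1'
        _ ≤ 1 / 8 := by norm_num
    linarith
  · rw [← hN, ← Real.exp_log (by positivity : 0 < N), ← Real.exp_nat_mul]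
    refine Real.exp_le_exp.2 ?_
    push_cast
    have hlog0 : 0 ≤ Real.log N := Real.log_nonneg (by linarith)
    have h44 : Real.exp (4 * β) = Real.exp (2 * β) * Real.exp (2 * β) := by
      rw [← Real.exp_add]; congr 1; ring
    calc s * M * Real.log N ≤ (11 * β) * Real.exp (2 * β) * Real.log N := by
          gcongr
          linarith
      _ = β * (11 * Real.log N) * Real.exp (2 * β) := by ring
      _ ≤ β * β * Real.exp (2 * β) := by gcongr
      _ ≤ Real.exp (2 * β) * Real.exp (2 * β) := by
          gcongr
          rw [hE2]
          nlinarith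
      _ = _ := h44.symm

end

/-! ### Largest clusters and the defect -/

section

section Giant

variable {d L : ℕ} {α β : ℝ} {Λ c : Finset (HLattice d L)} {ω : Edge d L → Bool}
  {x y : HLattice d L}

open Classical in
/-- A set of maximal size among the sets `C x`, `x ∈ Λ`. -/
noncomputable def largest (Λ : Finset (HLattice d L))
    (C : HLattice d L → Finset (HLattice d L)) : Finset (HLattice d L) :=
  if h : Λ.Nonempty then C (Λ.exists_max_image (fun x => (C x).card) h).choose else ∅

/-- A largest cluster of the graph formed by the open edges inside `Λ`. -/
noncomputable def giant (Λ : Finset (HLattice d L)) (ω : Edge d L → Bool) :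
    Finset (HLattice d L) :=
  largest Λ (clusterIn Λ ω)

theorem exists_giant_eq (h : Λ.Nonempty) (ω : Edge d L → Bool) :
    ∃ x ∈ Λ, giant Λ ω = clusterIn Λ ω x ∧
      ∀ y ∈ Λ, (clusterIn Λ ω y).card ≤ (giant Λ ω).card := by
  have hs := (Λ.exists_max_image (fun x => (clusterIn Λ ω x).card) h).choose_spec
  refine ⟨_, hs.1, ?_, fun y hy => ?_⟩
  · rw [giant, largest, dif_pos h]
  · rw [giant, largest, dif_pos h]
    exact hs.2 y hy

theorem giant_subset : giant Λ ω ⊆ Λ := by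
  by_cases h : Λ.Nonempty
  · obtain ⟨x, -, h, -⟩ := exists_giant_eq h ω
    exact h ▸ clusterIn_subset
  · rw [giant, largest, dif_neg h]
    exact Finset.empty_subset _

/-- Each vertex of the largest cluster contributes the size of that cluster to the sum. -/
theorem card_giant_sq_le_sum {Λ : Finset (HLattice d L)} (hΛ : Λ.Nonempty)
    (ω : Edge d L → Bool) :
    ((giant Λ ω).card : ℝ≥0∞) ^ 2 ≤ ∑ x ∈ Λ, ((clusterIn Λ ω x).card : ℝ≥0∞) := by
  obtain ⟨x, -, h, -⟩ := exists_giant_eq hΛ ω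
  calc ((giant Λ ω).card : ℝ≥0∞) ^ 2
      = ∑ y ∈ giant Λ ω, ((clusterIn Λ ω y).card : ℝ≥0∞) := by
        have hcl : ∀ y ∈ giant Λ ω, ((clusterIn Λ ω y).card : ℝ≥0∞) = (giant Λ ω).card :=
          fun y hy => by rw [clusterIn_eq_of_mem (h ▸ hy), h]
        rw [Finset.sum_congr rfl hcl, Finset.sum_const, nsmul_eq_mul, sq]
    _ ≤ _ := Finset.sum_le_sum_of_subset giant_subset

/-- Ties are broken by `largest` from the cluster map alone, so the choice brings in no further
edges. -/
theorem dependsOn_giant : DependsOn (giant Λ) (edgesIn Λ) := fun ω ω' h => by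
  simp only [giant, dependsOn_clusterIn h]

/-- The proportion of `Λ` not covered by the largest cluster. -/
noncomputable def defect (Λ : Finset (HLattice d L)) (ω : Edge d L → Bool) : ℝ :=
  1 - (giant Λ ω).card / Λ.card

/-- The defect, counted as at least one if no cluster covers half of `Λ`. -/
noncomputable def inflatedDefect (Λ : Finset (HLattice d L)) (ω : Edge d L → Bool) : ℝ :=
  defect Λ ω + if 1 / 2 < defect Λ ω then 1 else 0

theorem dependsOn_defect : DependsOn (defect Λ) (edgesIn Λ) := fun ω ω' h => by
  simp only [defect, dependsOn_giant h]

theorem dependsOn_inflatedDefect : DependsOn (inflatedDefect Λ) (edgesIn Λ) := fun ω ω' h => by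
  simp only [inflatedDefect, dependsOn_defect h]

theorem measurable_defect : Measurable (defect Λ) :=
  measurable_of_dependsOn dependsOn_defect (finite_crossEdges _ _)

theorem measurable_inflatedDefect : Measurable (inflatedDefect Λ) :=
  measurable_of_dependsOn dependsOn_inflatedDefect (finite_crossEdges _ _)

theorem defect_nonneg : 0 ≤ defect Λ ω :=
  sub_nonneg.2 (div_le_one_of_le₀ (Nat.cast_le.2 (Finset.card_le_card giant_subset))
    (Nat.cast_nonneg _))

theorem defect_le_one : defect Λ ω ≤ 1 := by
  have : (0 : ℝ) ≤ (giant Λ ω).card / Λ.card := by positivity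
  unfold defect
  linarith

theorem inflatedDefect_nonneg : 0 ≤ inflatedDefect Λ ω := by
  have := defect_nonneg (Λ := Λ) (ω := ω)
  unfold inflatedDefect
  split_ifs <;> linarith

/-- Chebyshev pointwise: the penalty is charged to the second moment. Charging it to the first would
multiply the mean by a constant at every level. -/
theorem inflatedDefect_le : inflatedDefect Λ ω ≤ defect Λ ω + 4 * defect Λ ω ^ 2 := by
  have := defect_nonneg (Λ := Λ) (ω := ω)
  unfold inflatedDefect
  split_ifs <;> nlinarith

theorem inflatedDefect_sq_le : inflatedDefect Λ ω ^ 2 ≤ 9 * defect Λ ω ^ 2 := by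
  have := defect_nonneg (Λ := Λ) (ω := ω)
  unfold inflatedDefect
  split_ifs <;> nlinarith

/-- Some two sets of the family have clusters covering at least half of them which are not joined
by an edge. -/
def giantsApart (F : Finset (Finset (HLattice d L))) : Set (Edge d L → Bool) :=
  ⋃ p ∈ F.offDiag, {ω | defect p.1 ω ≤ 1 / 2 ∧ defect p.2 ω ≤ 1 / 2 ∧
    ω ∈ noEdge (giant p.1 ω) (giant p.2 ω)}

theorem card_sdiff_le_mul_inflatedDefect {C : Finset (HLattice d L)} (hc : c.Nonempty)
    (h : defect c ω ≤ 1 / 2 → giant c ω ⊆ C) :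
    ((c \ C).card : ℝ) ≤ c.card * inflatedDefect c ω := by
  have hc0 : (0 : ℝ) < c.card := Nat.cast_pos.2 hc.card_pos
  have hd := defect_nonneg (Λ := c) (ω := ω)
  unfold inflatedDefect
  split_ifs with h1
  · have : ((c \ C).card : ℝ) ≤ c.card := Nat.cast_le.2 (Finset.card_le_card Finset.sdiff_subset)
    nlinarith
  · have h2 : ((c \ C).card : ℝ) ≤ (c \ giant c ω).card :=
      Nat.cast_le.2 (Finset.card_le_card (Finset.sdiff_subset_sdiff le_rfl (h (not_lt.1 h1))))
    rw [Finset.cast_card_sdiff giant_subset] at h2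
    rw [add_zero, defect, mul_sub, mul_one, mul_div_cancel₀ _ hc0.ne']
    exact h2

/-- If no two large clusters of the parts are apart, the proportion of vertices missed by the
largest cluster is controlled by the parts. -/
theorem card_mul_defect_le {F : Finset (Finset (HLattice d L))} (hF : F.biUnion id = Λ)
    (hΛ : Λ.Nonempty) (hne : ∀ c ∈ F, c.Nonempty) (hω : ω ∉ giantsApart F) :
    Λ.card * defect Λ ω ≤ ∑ c ∈ F, c.card * inflatedDefect c ω := by
  have hsub : ∀ c ∈ F, c ⊆ Λ := fun c hc => hF ▸ Finset.subset_biUnion_of_mem id hc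
  have hΛ0 : (0 : ℝ) < Λ.card := Nat.cast_pos.2 hΛ.card_pos
  have hcover : ∀ C : Finset (HLattice d L), C ⊆ Λ →
      (∀ c ∈ F, defect c ω ≤ 1 / 2 → giant c ω ⊆ C) →
      ((Λ.card : ℝ) - C.card) ≤ ∑ c ∈ F, c.card * inflatedDefect c ω := by
    intro C hC h
    rw [← Finset.cast_card_sdiff hC]
    have h1 : Λ \ C ⊆ F.biUnion fun c => c \ C := by
      intro y hy
      rw [Finset.mem_sdiff, ← hF, Finset.mem_biUnion] at hy
      obtain ⟨⟨c, hc, hyc⟩, hyC⟩ := hy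
      exact Finset.mem_biUnion.2 ⟨c, hc, Finset.mem_sdiff.2 ⟨hyc, hyC⟩⟩
    calc ((Λ \ C).card : ℝ) ≤ ((F.biUnion fun c => c \ C).card : ℝ) :=
          Nat.cast_le.2 (Finset.card_le_card h1)
      _ ≤ ((∑ c ∈ F, (c \ C).card : ℕ) : ℝ) := Nat.cast_le.2 Finset.card_biUnion_le
      _ = ∑ c ∈ F, ((c \ C).card : ℝ) := Nat.cast_sum _ _
      _ ≤ _ := Finset.sum_le_sum fun c hc =>
          card_sdiff_le_mul_inflatedDefect (hne c hc) (h c hc)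
  -- If some part is good, the cluster in `Λ` containing its largest cluster contains those of all
  -- good parts, since none are apart. If no part is good, the penalties alone exceed the trivial
  -- bound 1 on the defect, which is the covering estimate with the empty set.
  by_cases hgood : ∃ c ∈ F, defect c ω ≤ 1 / 2
  · obtain ⟨c, hc, hcd⟩ := hgood
    obtain ⟨x, hx, hgx, -⟩ := exists_giant_eq (hne c hc) ω
    obtain ⟨_, _, _, hmax⟩ := exists_giant_eq hΛ ω
    refine le_trans ?_ (hcover (clusterIn Λ ω x) clusterIn_subset ?_)
    · rw [defect, mul_sub, mul_one, mul_div_cancel₀ _ hΛ0.ne']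
      exact sub_le_sub_left (Nat.cast_le.2 (hmax x (hsub c hc hx))) _
    · intro c' hc' hcd'
      by_cases hcc : c = c'
      · rw [← hcc, hgx]
        exact clusterIn_mono (hsub c hc)
      · have hω' : ω ∉ noEdge (giant c ω) (giant c' ω) := fun h => hω <|
          Set.mem_biUnion (x := (c, c')) (Finset.mem_coe.2 (Finset.mem_offDiag.2 ⟨hc, hc', hcc⟩))
            ⟨hcd, hcd', h⟩
        simp only [noEdge, Set.mem_ofPred_eq, not_forall, not_not] at hω'
        obtain ⟨u, hu, v, hv, huv⟩ := hω'
        rw [hgx] at hu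
        have h1 : v ∈ clusterIn Λ ω x := mem_clusterIn_of_adj (clusterIn_mono (hsub c hc) hu) huv
          (hsub c' hc' (giant_subset hv))
        obtain ⟨x', -, hgx', -⟩ := exists_giant_eq (hne c' hc') ω
        rw [hgx'] at hv ⊢
        rw [← clusterIn_eq_of_mem h1, ← clusterIn_eq_of_mem hv]
        exact clusterIn_mono (hsub c' hc')
  · push Not at hgood
    have h := hcover ∅ (Finset.empty_subset _) fun c hc h => absurd h (not_le.2 (hgood c hc))
    rw [Finset.card_empty, Nat.cast_zero, sub_zero] at h
    nlinarith [defect_le_one (Λ := Λ) (ω := ω)]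

theorem lintegral_mul_inflatedDefect {c c' : Finset (HLattice d L)} (h : Disjoint c c') :
    ∫⁻ ω, ENNReal.ofReal (inflatedDefect c ω) * ENNReal.ofReal (inflatedDefect c' ω)
        ∂(percMeasure d L α β) =
      (∫⁻ ω, ENNReal.ofReal (inflatedDefect c ω) ∂(percMeasure d L α β)) *
        ∫⁻ ω, ENNReal.ofReal (inflatedDefect c' ω) ∂(percMeasure d L α β) := by
  refine lintegral_mul_eq_lintegral_mul_lintegral_of_indepFun''
    measurable_inflatedDefect.ennreal_ofReal.aemeasurable
    measurable_inflatedDefect.ennreal_ofReal.aemeasurable ?_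
  refine (indepFun_of_dependsOn dependsOn_inflatedDefect dependsOn_inflatedDefect
    (finite_crossEdges _ _) (finite_crossEdges _ _) ?_).comp
    ENNReal.measurable_ofReal ENNReal.measurable_ofReal
  refine disjoint_crossEdges fun a ha b _ a' ha' b' hb' => ?_
  exact ⟨fun h' => Finset.disjoint_left.1 h ha (h'.1 ▸ ha'),
    fun h' => Finset.disjoint_left.1 h ha (h'.1 ▸ hb')⟩

end Giant

end

/-! ### Merging blocks and the moment recursion -/

section

section Giant

variable {d L : ℕ} {α β : ℝ}

/-- Conditionally on the clusters inside two disjoint sets, the edges between them are fresh. -/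
theorem measure_giants_apart_le {A B : Finset (HLattice d L)} (hAB : Disjoint A B) {q : ℝ≥0∞}
    (hq : ∀ a ⊆ A, ∀ b ⊆ B, (A.card : ℝ) ≤ 2 * a.card → (B.card : ℝ) ≤ 2 * b.card →
      percMeasure d L α β (noEdge a b) ≤ q) (hA : A.Nonempty) (hB : B.Nonempty) :
    percMeasure d L α β {ω | defect A ω ≤ 1 / 2 ∧ defect B ω ≤ 1 / 2 ∧
      ω ∈ noEdge (giant A ω) (giant B ω)} ≤ q := by
  classical
  set S := (A.powerset ×ˢ B.powerset).filter
    fun p => (A.card : ℝ) ≤ 2 * p.1.card ∧ (B.card : ℝ) ≤ 2 * p.2.card with hS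
  have hsize : ∀ (Λ : Finset (HLattice d L)) (ω : Edge d L → Bool), Λ.Nonempty →
      defect Λ ω ≤ 1 / 2 → (Λ.card : ℝ) ≤ 2 * (giant Λ ω).card := by
    intro Λ ω hΛ h
    have hΛ0 : (0 : ℝ) < Λ.card := Nat.cast_pos.2 hΛ.card_pos
    rw [defect, sub_le_comm, le_div_iff₀ hΛ0] at h
    linarith
  have hsub : {ω | defect A ω ≤ 1 / 2 ∧ defect B ω ≤ 1 / 2 ∧
      ω ∈ noEdge (giant A ω) (giant B ω)} ⊆
      -- Fixing the two largest clusters involves only edges inside `A` or inside `B`, so the edges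
      -- between them remain independent. A defect at most 1/2 forces both sets to fill half.
      ⋃ p ∈ S, {ω | giant A ω = p.1 ∧ giant B ω = p.2} ∩ noEdge p.1 p.2 := by
    rintro ω ⟨h1, h2, h3⟩
    refine Set.mem_biUnion (x := (giant A ω, giant B ω)) ?_ ⟨⟨rfl, rfl⟩, h3⟩
    exact Finset.mem_coe.2 (Finset.mem_filter.2 ⟨Finset.mem_product.2
      ⟨Finset.mem_powerset.2 giant_subset, Finset.mem_powerset.2 giant_subset⟩,
      hsize A ω hA h1, hsize B ω hB h2⟩)
  have hdep : ∀ p : Finset (HLattice d L) × Finset (HLattice d L),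
      DependsOn (fun ω => ω ∈ {ω | giant A ω = p.1 ∧ giant B ω = p.2})
        (edgesIn A ∪ edgesIn B) := by
    intro p ω ω' h
    simp only [Set.mem_ofPred_eq, dependsOn_giant (Λ := A) fun e he => h e (Or.inl he),
      dependsOn_giant (Λ := B) fun e he => h e (Or.inr he)]
  have hfin : (edgesIn A ∪ edgesIn B : Set (Edge d L)).Finite :=
    (finite_crossEdges _ _).union (finite_crossEdges _ _)
  refine (measure_mono hsub).trans ((measure_biUnion_finset_le _ _).trans ?_)
  calc ∑ p ∈ S, percMeasure d L α β
        ({ω | giant A ω = p.1 ∧ giant B ω = p.2} ∩ noEdge p.1 p.2)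
      ≤ ∑ p ∈ S, percMeasure d L α β {ω | giant A ω = p.1 ∧ giant B ω = p.2} * q := by
        refine Finset.sum_le_sum fun p hp => ?_
        simp only [hS, Finset.mem_filter, Finset.mem_product, Finset.mem_powerset] at hp
        obtain ⟨⟨hp1, hp2⟩, hp3, hp4⟩ := hp
        rw [percMeasure, measure_inter_of_dependsOn (hdep p) (dependsOn_noEdge p.1 p.2) hfin
          (finite_crossEdges _ _), ← percMeasure]
        · gcongr
          exact hq p.1 hp1 p.2 hp2 hp3 hp4
        · rw [Set.disjoint_union_left]
          constructor
          · refine disjoint_crossEdges fun a ha b hb a' ha' b' hb' => ?_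
            exact ⟨fun h => Finset.disjoint_left.1 hAB hb (h.2 ▸ hp2 hb'),
              fun h => Finset.disjoint_left.1 hAB ha (h.1 ▸ hp2 hb')⟩
          · refine disjoint_crossEdges fun a ha b hb a' ha' b' hb' => ?_
            exact ⟨fun h => Finset.disjoint_left.1 hAB (hp1 ha') (h.1 ▸ ha),
              fun h => Finset.disjoint_left.1 hAB (hp1 ha') (h.2 ▸ hb)⟩
    _ ≤ 1 * q := by
        rw [← Finset.sum_mul, ← measure_biUnion_finset]
        · gcongr
          exact prob_le_one
        · intro p _ p' _ hpp
          refine Set.disjoint_left.2 fun ω h h' => hpp ?_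
          exact Prod.ext (h.1.symm.trans h'.1) (h.2.symm.trans h'.2)
        · intro p _
          exact measurableSet_of_dependsOn (hdep p) hfin
    _ = q := one_mul q

end Giant

variable {d L : ℕ} {β : ℝ} [NeZero L]

theorem measure_giantsApart_le (hβ : 0 ≤ β) (n k : ℕ) (x : HLattice d L) :
    percMeasure d L d β (giantsApart (children n k x)) ≤
      ENNReal.ofReal ((((L : ℝ) ^ d) ^ k) ^ 2 *
        Real.exp (-(β / (4 * (((L : ℝ) ^ d) ^ k) ^ 2)))) := by
  have hL0 : (0 : ℝ) < L := by exact_mod_cast NeZero.pos L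
  set N : ℝ := (L : ℝ) ^ d with hN
  have hN0 : 0 < N := by positivity
  set q := Real.exp (-(β / (4 * (N ^ k) ^ 2))) with hq
  refine (measure_biUnion_finset_le _ _).trans ?_
  calc _ ≤ ∑ p ∈ (children n k x).offDiag, ENNReal.ofReal q := by
        refine Finset.sum_le_sum fun p hp => ?_
        obtain ⟨h1, h2, h12⟩ := Finset.mem_offDiag.1 hp
        have hdisj : Disjoint p.1 p.2 := pairwiseDisjoint_children h1 h2 h12
        have hcard : ∀ c ∈ children n k x, (c.card : ℝ) = N ^ n := fun c hc => by
          rw [card_of_mem_children hc]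
          push_cast
          rfl
        have hne : ∀ c ∈ children n k x, c.Nonempty := fun c hc => by
          rw [← Finset.card_pos, card_of_mem_children hc]
          exact pow_pos (pow_pos (NeZero.pos L) _) _
        refine measure_giants_apart_le hdisj ?_ (hne _ h1) (hne _ h2)
        intro a ha b hb hsa hsb
        rw [hcard _ h1] at hsa
        rw [hcard _ h2] at hsb
        have hab : Disjoint a b := hdisj.mono ha hb
        rw [measure_noEdge hβ hab]
        refine ENNReal.ofReal_le_ofReal (Real.exp_le_exp.2 (neg_le_neg ?_))
        rw [div_eq_mul_one_div]
        refine mul_le_mul_of_nonneg_left ?_ hβ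
        refine le_trans ?_ (mul_le_sum_sum_rate (α := d) (Nat.cast_nonneg d)
          (ha.trans (subset_of_mem_children h1)) (hb.trans (subset_of_mem_children h2)) hab)
        have hexp : ((L : ℝ) ^ (n + k)) ^ (-(d : ℝ) - d) = ((N ^ (n + k)) ^ 2)⁻¹ := by
          rw [hN]
          simp only [← Real.rpow_natCast, ← Real.rpow_mul hL0.le]
          rw [← Real.rpow_neg hL0.le]
          congr 1
          push_cast
          ring
        rw [hexp]
        -- Two half-filled blocks of volume N^n, at rate at least N^(-2(n+k)) per pair: at α = d the
        -- level `n` cancels.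
        calc 1 / (4 * (N ^ k) ^ 2) = (N ^ n / 2) * (N ^ n / 2) * ((N ^ (n + k)) ^ 2)⁻¹ := by
              rw [pow_add]
              field_simp
              norm_num
          _ ≤ a.card * b.card * ((N ^ (n + k)) ^ 2)⁻¹ := by
              gcongr <;> linarith
    _ ≤ ENNReal.ofReal ((N ^ k) ^ 2) * ENNReal.ofReal q := by
        rw [Finset.sum_const, nsmul_eq_mul]
        gcongr
        rw [Finset.offDiag_card, card_children, ← ENNReal.ofReal_natCast]
        refine ENNReal.ofReal_le_ofReal ?_
        calc (((L ^ d) ^ k * (L ^ d) ^ k - (L ^ d) ^ k : ℕ) : ℝ)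
            ≤ (((L ^ d) ^ k * (L ^ d) ^ k : ℕ) : ℝ) := Nat.cast_le.2 (Nat.sub_le _ _)
          _ = (N ^ k) ^ 2 := by push_cast; rw [sq]
    _ = _ := (ENNReal.ofReal_mul (by positivity)).symm

theorem measurableSet_giantsApart (n k : ℕ) (x : HLattice d L) :
    MeasurableSet (giantsApart (children n k x)) := by
  refine measurableSet_of_dependsOn (S := edgesIn (block (n + k) x)) ?_ (finite_crossEdges _ _)
  intro ω ω' h
  have hg : ∀ c ∈ children n k x, giant c ω = giant c ω' := fun c hc =>
    dependsOn_giant fun e he => h e (by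
      obtain ⟨a, ha, b, hb, he⟩ := he
      exact ⟨a, subset_of_mem_children hc ha, b, subset_of_mem_children hc hb, he⟩)
  simp only [giantsApart, Set.mem_iUnion, Set.mem_ofPred_eq, exists_prop]
  refine propext (exists_congr fun p => and_congr_right fun hp => ?_)
  obtain ⟨h1, h2, -⟩ := Finset.mem_offDiag.1 hp
  rw [defect, defect, defect, defect, hg _ h1, hg _ h2]
  refine and_congr_right fun _ => and_congr_right fun _ => iff_of_eq (dependsOn_noEdge _ _ ?_)
  rintro e ⟨a, ha, b, hb, he⟩
  exact h e ⟨a, subset_of_mem_children h1 (giant_subset ha), b,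
    subset_of_mem_children h2 (giant_subset hb), he⟩

/-- On the bad event the defect and its square are at most 1, so the same indicator serves both
bounds. -/
theorem defect_block_le {n k : ℕ} {x : HLattice d L} (ω : Edge d L → Bool) :
    ENNReal.ofReal (defect (block (n + k) x) ω) ≤
      ENNReal.ofReal (((L : ℝ) ^ d) ^ k)⁻¹ *
        ∑ c ∈ children n k x, ENNReal.ofReal (inflatedDefect c ω) +
      (giantsApart (children n k x)).indicator 1 ω ∧
    ENNReal.ofReal (defect (block (n + k) x) ω) ^ 2 ≤
      (ENNReal.ofReal (((L : ℝ) ^ d) ^ k)⁻¹ *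
        ∑ c ∈ children n k x, ENNReal.ofReal (inflatedDefect c ω)) ^ 2 +
      (giantsApart (children n k x)).indicator 1 ω := by
  have hL0 : (0 : ℝ) < L := by exact_mod_cast NeZero.pos L
  have h1 : ENNReal.ofReal (defect (block (n + k) x) ω) ≤ 1 :=
    ENNReal.ofReal_le_one.2 defect_le_one
  by_cases hω : ω ∈ giantsApart (children n k x)
  · rw [Set.indicator_of_mem hω]
    exact ⟨le_add_left h1, le_add_left (pow_le_one' h1 2)⟩
  · rw [Set.indicator_of_notMem hω, add_zero, add_zero]
    have key := card_mul_defect_le (Λ := block (n + k) x) biUnion_children ⟨x, self_mem_block⟩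
      (fun c hc => by
        rw [← Finset.card_pos, card_of_mem_children hc]
        exact pow_pos (pow_pos (NeZero.pos L) _) _) hω
    have key' : ENNReal.ofReal (defect (block (n + k) x) ω) ≤
        ENNReal.ofReal (((L : ℝ) ^ d) ^ k)⁻¹ *
          ∑ c ∈ children n k x, ENNReal.ofReal (inflatedDefect c ω) := by
      rw [← ENNReal.ofReal_sum_of_nonneg fun _ _ => inflatedDefect_nonneg,
        ← ENNReal.ofReal_mul (by positivity)]
      refine ENNReal.ofReal_le_ofReal ?_
      rw [card_block, Finset.sum_congr rfl fun c hc => by rw [card_of_mem_children hc],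
        ← Finset.mul_sum] at key
      push_cast at key
      rw [pow_add, mul_assoc] at key
      have h2 := le_of_mul_le_mul_left key (by positivity)
      rwa [inv_mul_eq_div, le_div_iff₀ (by positivity), mul_comm]
    exact ⟨key', pow_le_pow_left' key' 2⟩

/-- The recursion for the first two moments of the defect. -/
theorem defect_moments_step {n k : ℕ} {m s ε : ℝ} (hm : 0 ≤ m) (hs : 0 ≤ s) (hε : 0 ≤ ε)
    (h1 : ∀ x : HLattice d L,
      ∫⁻ ω, ENNReal.ofReal (defect (block n x) ω) ∂(percMeasure d L d β) ≤ ENNReal.ofReal m)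
    (h2 : ∀ x : HLattice d L,
      ∫⁻ ω, ENNReal.ofReal (defect (block n x) ω) ^ 2 ∂(percMeasure d L d β) ≤ ENNReal.ofReal s)
    (hD : ∀ x : HLattice d L,
      percMeasure d L d β (giantsApart (children n k x)) ≤ ENNReal.ofReal ε)
    (x : HLattice d L) :
    ∫⁻ ω, ENNReal.ofReal (defect (block (n + k) x) ω) ∂(percMeasure d L d β) ≤
      ENNReal.ofReal (m + 4 * s + ε) ∧
    ∫⁻ ω, ENNReal.ofReal (defect (block (n + k) x) ω) ^ 2 ∂(percMeasure d L d β) ≤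
      ENNReal.ofReal (9 * s / ((L : ℝ) ^ d) ^ k + (m + 4 * s) ^ 2 + ε) := by
  have hL0 : (0 : ℝ) < L := by exact_mod_cast NeZero.pos L
  set P := percMeasure d L d β with hP
  set M : ℝ := ((L : ℝ) ^ d) ^ k with hM
  have hM0 : 0 < M := by positivity
  set F := children n k x with hF
  have hcard : (F.card : ℝ≥0∞) = ENNReal.ofReal M := by
    rw [hF, card_children, ← ENNReal.ofReal_natCast]
    push_cast
    rfl
  have hmeas : ∀ c : Finset (HLattice d L),
      Measurable fun ω => ENNReal.ofReal (inflatedDefect c ω) :=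
    fun c => measurable_inflatedDefect.ennreal_ofReal
  have hmul : ∀ c c' : Finset (HLattice d L), Measurable fun ω =>
      ENNReal.ofReal (inflatedDefect c ω) * ENNReal.ofReal (inflatedDefect c' ω) :=
    fun c c' => (hmeas c).mul (hmeas c')
  have hf1 : ∀ c ∈ F, ∫⁻ ω, ENNReal.ofReal (inflatedDefect c ω) ∂P ≤
      ENNReal.ofReal (m + 4 * s) := by
    intro c hc
    obtain ⟨y, -, rfl⟩ := mem_children.1 hc
    calc _ ≤ ∫⁻ ω, (ENNReal.ofReal (defect (block n y) ω) +
          4 * ENNReal.ofReal (defect (block n y) ω) ^ 2) ∂P := by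
          refine lintegral_mono fun ω => ?_
          refine (ENNReal.ofReal_le_ofReal inflatedDefect_le).trans (le_of_eq ?_)
          rw [ENNReal.ofReal_add defect_nonneg (mul_nonneg (by norm_num) (sq_nonneg _)),
            ENNReal.ofReal_mul (by norm_num), ENNReal.ofReal_pow defect_nonneg]
          simp
      _ = ∫⁻ ω, ENNReal.ofReal (defect (block n y) ω) ∂P +
          4 * ∫⁻ ω, ENNReal.ofReal (defect (block n y) ω) ^ 2 ∂P := by
          rw [lintegral_add_left measurable_defect.ennreal_ofReal,
            lintegral_const_mul _ (measurable_defect.ennreal_ofReal.pow_const 2)]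
      _ ≤ ENNReal.ofReal m + 4 * ENNReal.ofReal s := by
          gcongr
          · exact h1 y
          · exact h2 y
      _ = _ := by
          rw [ENNReal.ofReal_add hm (by positivity), ENNReal.ofReal_mul (by norm_num)]
          simp
  have hf2 : ∀ c ∈ F, ∫⁻ ω, ENNReal.ofReal (inflatedDefect c ω) *
      ENNReal.ofReal (inflatedDefect c ω) ∂P ≤ ENNReal.ofReal (9 * s) := by
    intro c hc
    obtain ⟨y, -, rfl⟩ := mem_children.1 hc
    calc _ ≤ ∫⁻ ω, 9 * ENNReal.ofReal (defect (block n y) ω) ^ 2 ∂P := by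
          refine lintegral_mono fun ω => ?_
          change ENNReal.ofReal _ * ENNReal.ofReal _ ≤ _
          rw [← ENNReal.ofReal_mul inflatedDefect_nonneg, ← sq]
          refine (ENNReal.ofReal_le_ofReal inflatedDefect_sq_le).trans (le_of_eq ?_)
          rw [ENNReal.ofReal_mul (by norm_num), ENNReal.ofReal_pow defect_nonneg]
          simp
      _ = 9 * ∫⁻ ω, ENNReal.ofReal (defect (block n y) ω) ^ 2 ∂P :=
          lintegral_const_mul _ (measurable_defect.ennreal_ofReal.pow_const 2)
      _ ≤ 9 * ENNReal.ofReal s := by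
          gcongr
          exact h2 y
      _ = _ := by
          rw [ENNReal.ofReal_mul (by norm_num)]
          simp
  have hD' : ∫⁻ ω, (giantsApart F).indicator 1 ω ∂P ≤ ENNReal.ofReal ε := by
    rw [lintegral_indicator_one (measurableSet_giantsApart n k x)]
    exact hD x
  have hsum : Measurable fun ω => ∑ c ∈ F, ENNReal.ofReal (inflatedDefect c ω) :=
    Finset.measurable_sum _ fun c _ => hmeas c
  constructor
  · calc _ ≤ ∫⁻ ω, (ENNReal.ofReal M⁻¹ * ∑ c ∈ F, ENNReal.ofReal (inflatedDefect c ω) +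
          (giantsApart F).indicator 1 ω) ∂P := lintegral_mono fun ω => (defect_block_le ω).1
      _ = ENNReal.ofReal M⁻¹ * ∑ c ∈ F, ∫⁻ ω, ENNReal.ofReal (inflatedDefect c ω) ∂P +
          ∫⁻ ω, (giantsApart F).indicator 1 ω ∂P := by
          rw [lintegral_add_left (hsum.const_mul _), lintegral_const_mul _ hsum,
            lintegral_finsetSum _ fun c _ => hmeas c]
      _ ≤ ENNReal.ofReal M⁻¹ * ∑ c ∈ F, ENNReal.ofReal (m + 4 * s) + ENNReal.ofReal ε := by
          gcongr with c hc
          exact hf1 c hc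
      _ = _ := by
          rw [Finset.sum_const, nsmul_eq_mul, hcard, ← ENNReal.ofReal_mul hM0.le,
            ← ENNReal.ofReal_mul (by positivity),
            ← ENNReal.ofReal_add (by positivity) hε, inv_mul_cancel_left₀ hM0.ne']
  · calc _ ≤ ∫⁻ ω, ((ENNReal.ofReal M⁻¹ * ∑ c ∈ F, ENNReal.ofReal (inflatedDefect c ω)) ^ 2 +
          (giantsApart F).indicator 1 ω) ∂P := lintegral_mono fun ω => (defect_block_le ω).2
      _ = ENNReal.ofReal M⁻¹ ^ 2 * ∑ c ∈ F, ∑ c' ∈ F, ∫⁻ ω, ENNReal.ofReal (inflatedDefect c ω) *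
            ENNReal.ofReal (inflatedDefect c' ω) ∂P +
          ∫⁻ ω, (giantsApart F).indicator 1 ω ∂P := by
          rw [lintegral_add_left ((hsum.const_mul _).pow_const 2)]
          simp only [mul_pow]
          rw [lintegral_const_mul _ (hsum.pow_const 2)]
          simp only [sq, Finset.sum_mul_sum]
          rw [lintegral_finsetSum _ fun c _ => Finset.measurable_sum _ fun c' _ => hmul c c']
          congr 2
          exact Finset.sum_congr rfl fun c _ => lintegral_finsetSum _ fun c' _ => hmul c c'
      -- Distinct children are independent, so only the M diagonal terms carry second moments; after
      -- division by M^2 they give the contracting term 9s/M.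
      _ ≤ ENNReal.ofReal M⁻¹ ^ 2 * ∑ c ∈ F, ∑ c' ∈ F,
            ((if c = c' then ENNReal.ofReal (9 * s) else 0) +
              ENNReal.ofReal (m + 4 * s) * ENNReal.ofReal (m + 4 * s)) + ENNReal.ofReal ε := by
          gcongr with c hc c' hc'
          split_ifs with hcc
          · subst hcc
            exact le_add_right (hf2 c hc)
          · have hdisj : Disjoint c c' := pairwiseDisjoint_children hc hc' hcc
            rw [zero_add, lintegral_mul_inflatedDefect hdisj]
            exact mul_le_mul' (hf1 c hc) (hf1 c' hc')
      _ = ENNReal.ofReal M⁻¹ ^ 2 * (ENNReal.ofReal M * ENNReal.ofReal (9 * s) +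
            ENNReal.ofReal M * (ENNReal.ofReal M *
              (ENNReal.ofReal (m + 4 * s) * ENNReal.ofReal (m + 4 * s)))) +
            ENNReal.ofReal ε := by
          simp only [Finset.sum_add_distrib, Finset.sum_ite_eq, Finset.sum_const, nsmul_eq_mul,
            hcard]
          congr 3
          rw [Finset.sum_congr rfl fun c hc => if_pos hc, Finset.sum_const, nsmul_eq_mul, hcard]
      _ = _ := by
          rw [← ENNReal.ofReal_pow (by positivity)]
          simp only [← ENNReal.ofReal_mul hM0.le,
            ← ENNReal.ofReal_mul (show 0 ≤ m + 4 * s by positivity)]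
          rw [← ENNReal.ofReal_add (by positivity) (by positivity),
            ← ENNReal.ofReal_mul (by positivity), ← ENNReal.ofReal_add (by positivity) hε]
          congr 1
          field_simp

end

/-! ### The case α = d: lower bound -/

section

variable {d L : ℕ} {β : ℝ} [NeZero L]

theorem defect_block_zero (x : HLattice d L) (ω : Edge d L → Bool) :
    defect (block 0 x) ω = 0 := by
  have hx : x ∈ block 0 x := self_mem_block
  obtain ⟨y, hy, h, -⟩ := exists_giant_eq ⟨x, hx⟩ ω
  have h1 : (giant (block 0 x) ω).card = 1 := by
    refine le_antisymm ?_ (Finset.card_pos.2 ⟨y, h ▸ self_mem_clusterIn hy⟩)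
    calc _ ≤ (block 0 x).card := Finset.card_le_card giant_subset
      _ = 1 := by rw [card_block, pow_zero]
  rw [defect, h1, card_block]
  simp

/-- The mean grows by 4·10r^2 + r^2 = 41r^2 per step, while the second moment reproduces itself:
90r^2/M ≤ 5r^2 for M ≥ 18, the squared mean is at most (2r)^2, and 5 + 4 + 1 = 10. This lasts while
the mean is of order r, that is, for about 1/r steps. -/
theorem defect_moments_le {k : ℕ} {r : ℝ} (hr0 : 0 ≤ r)
    (hM : 18 ≤ ((L : ℝ) ^ d) ^ k)
    (hD : ∀ (n : ℕ) (x : HLattice d L),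
      percMeasure d L d β (giantsApart (children n k x)) ≤ ENNReal.ofReal (r ^ 2))
    (j : ℕ) (hj : 41 * r * j ≤ 1) (x : HLattice d L) :
    ∫⁻ ω, ENNReal.ofReal (defect (block (k * j) x) ω) ∂(percMeasure d L d β) ≤
      ENNReal.ofReal (41 * r ^ 2 * j) ∧
    ∫⁻ ω, ENNReal.ofReal (defect (block (k * j) x) ω) ^ 2 ∂(percMeasure d L d β) ≤
      ENNReal.ofReal (10 * r ^ 2) := by
  induction j generalizing x with
  | zero => simp [defect_block_zero]
  | succ j ih =>
    push_cast at hj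
    have hj' : 41 * r * j ≤ 1 := by nlinarith
    have hstep := defect_moments_step (n := k * j) (k := k) (m := 41 * r ^ 2 * j)
      (s := 10 * r ^ 2) (ε := r ^ 2) (by positivity) (by positivity) (by positivity)
      (fun x => (ih hj' x).1) (fun x => (ih hj' x).2) (hD _) x
    rw [Nat.mul_succ]
    refine ⟨hstep.1.trans (ENNReal.ofReal_le_ofReal ?_),
      hstep.2.trans (ENNReal.ofReal_le_ofReal ?_)⟩
    · push_cast
      linarith
    · have h1 : 9 * (10 * r ^ 2) / ((L : ℝ) ^ d) ^ k ≤ 5 * r ^ 2 := by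
        rw [div_le_iff₀ (by linarith)]
        nlinarith [sq_nonneg r]
      have h2 : 41 * r ^ 2 * j + 4 * (10 * r ^ 2) ≤ 2 * r := by nlinarith
      have h3 : (41 * r ^ 2 * j + 4 * (10 * r ^ 2)) ^ 2 ≤ (2 * r) ^ 2 := by gcongr
      linarith

theorem card_block_le_meanSize {n : ℕ} {s : ℝ} (hs : 4 * s ≤ 1)
    (h : ∫⁻ ω, ENNReal.ofReal (defect (block n (0 : HLattice d L)) ω) ^ 2
      ∂(percMeasure d L d β) ≤ ENNReal.ofReal s) :
    ENNReal.ofReal (((L : ℝ) ^ d) ^ n / 4) ≤ meanSize d β (block n 0) (0 : HLattice d L) := by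
  have hL0 : (0 : ℝ) < L := by exact_mod_cast NeZero.pos L
  set Λ := block n (0 : HLattice d L) with hΛ
  set P := percMeasure d L d β with hP
  set K : ℝ≥0∞ := (Λ.card : ℝ≥0∞) with hK
  have hΛne : Λ.Nonempty := ⟨0, self_mem_block⟩
  have hK0 : K ≠ 0 := Nat.cast_ne_zero.2 hΛne.card_pos.ne'
  have hKtop : K ≠ ∞ := ENNReal.natCast_ne_top _
  have hKeq : K = ENNReal.ofReal (((L : ℝ) ^ d) ^ n) := by
    rw [hK, hΛ, card_block, ← ENNReal.ofReal_natCast]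
    push_cast
    rfl
  -- This is 1 ≤ 2(1-δ)^2 + 2δ^2 for the defect δ, combined with the bound of the squared largest
  -- cluster by the sum of cluster sizes.
  have hpt : ∀ ω, K ^ 2 ≤ 2 * ∑ x ∈ Λ, ((clusterIn Λ ω x).card : ℝ≥0∞) +
      2 * K ^ 2 * ENNReal.ofReal (defect Λ ω) ^ 2 := by
    intro ω
    refine le_trans ?_ (add_le_add_left (mul_le_mul_right (card_giant_sq_le_sum hΛne ω) 2) _)
    have hΛ0 : (0 : ℝ) < Λ.card := Nat.cast_pos.2 hΛne.card_pos
    have hg : ((giant Λ ω).card : ℝ) = Λ.card * (1 - defect Λ ω) := by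
      rw [defect, sub_sub_cancel, mul_div_cancel₀ _ hΛ0.ne']
    have hreal : (Λ.card : ℝ) ^ 2 ≤ 2 * ((giant Λ ω).card : ℝ) ^ 2 +
        2 * (Λ.card : ℝ) ^ 2 * defect Λ ω ^ 2 := by
      rw [hg]
      nlinarith [sq_nonneg ((Λ.card : ℝ) * (1 - 2 * defect Λ ω))]
    have h2 := ENNReal.ofReal_le_ofReal hreal
    rw [ENNReal.ofReal_add (by positivity) (by positivity), ENNReal.ofReal_mul (by norm_num),
      ENNReal.ofReal_mul (by positivity), ENNReal.ofReal_mul (by norm_num),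
      ENNReal.ofReal_pow (by positivity), ENNReal.ofReal_pow (by positivity),
      ENNReal.ofReal_pow defect_nonneg, ENNReal.ofReal_natCast, ENNReal.ofReal_natCast,
      ENNReal.ofReal_ofNat] at h2
    exact h2
  -- Translation invariance passes from the average over all starting points to the cluster of 0.
  have hsumeq : ∫⁻ ω, ∑ x ∈ Λ, ((clusterIn Λ ω x).card : ℝ≥0∞) ∂P = K * meanSize d β Λ 0 := by
    rw [lintegral_finsetSum _ fun x _ => measurable_card_clusterIn x]
    rw [Finset.sum_congr rfl fun x hx => (?_ : _ = meanSize d β Λ 0), Finset.sum_const,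
      nsmul_eq_mul]
    rw [hΛ, ← meanSize_block_eq n x, block_eq_of_mem hx]
    rfl
  have hint : K ^ 2 ≤ 2 * (K * meanSize d β Λ 0) + 2 * K ^ 2 * ENNReal.ofReal s := by
    calc K ^ 2 = ∫⁻ _, K ^ 2 ∂P := by simp
      _ ≤ ∫⁻ ω, (2 * ∑ x ∈ Λ, ((clusterIn Λ ω x).card : ℝ≥0∞) +
          2 * K ^ 2 * ENNReal.ofReal (defect Λ ω) ^ 2) ∂P := lintegral_mono hpt
      _ = 2 * (K * meanSize d β Λ 0) +
          2 * K ^ 2 * ∫⁻ ω, ENNReal.ofReal (defect Λ ω) ^ 2 ∂P := by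
          have hm : Measurable fun ω => ∑ x ∈ Λ, ((clusterIn Λ ω x).card : ℝ≥0∞) :=
            Finset.measurable_sum _ fun x _ => measurable_card_clusterIn x
          rw [lintegral_add_left (hm.const_mul 2), lintegral_const_mul _ hm, hsumeq,
            lintegral_const_mul _ (measurable_defect.ennreal_ofReal.pow_const 2)]
      _ ≤ _ := by gcongr
  have hsize : meanSize d β Λ 0 ≠ ∞ := ne_top_of_le_ne_top hKtop (meanSize_le_card 0)
  set S := meanSize d β Λ 0 with hS
  have hs0 : 0 ≤ max s 0 := le_max_right _ _
  have hs4 : 4 * max s 0 ≤ 1 := by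
    rcases max_cases s 0 with h | h <;> rw [h.1] <;> linarith
  have hreal : (Λ.card : ℝ) ^ 2 ≤ 2 * (Λ.card * S.toReal) +
      2 * (Λ.card : ℝ) ^ 2 * max s 0 := by
    have h3 := ENNReal.toReal_mono (by finiteness) hint
    rw [ENNReal.toReal_add (by finiteness) (by finiteness)] at h3
    simpa [hK, ENNReal.toReal_ofReal'] using h3
  have hΛ0 : (0 : ℝ) < Λ.card := Nat.cast_pos.2 hΛne.card_pos
  rw [ENNReal.ofReal_le_iff_le_toReal hsize]
  have hcard : (Λ.card : ℝ) = ((L : ℝ) ^ d) ^ n := by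
    rw [hΛ, card_block]
    push_cast
    rfl
  rw [← hcard]
  nlinarith

theorem exp_exp_le_susceptibility (hL : 2 ≤ L) (hd : 1 ≤ d) : ∃ c : ℝ, 0 < c ∧
    ∀ᶠ β : ℝ in atTop,
      ENNReal.ofReal (Real.exp (Real.exp (c * β))) ≤ susceptibility d L d β := by
  have hL0 : (2 : ℝ) ≤ L := by exact_mod_cast hL
  set N : ℝ := (L : ℝ) ^ d with hN
  have hN2 : 2 ≤ N := by
    calc (2 : ℝ) ≤ L := hL0
      _ = (L : ℝ) ^ 1 := (pow_one _).symm
      _ ≤ N := pow_le_pow_right₀ (by linarith) hd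
  -- As N ≥ 2, five levels at a time give M ≥ 32, enough for the contraction (18) and for M ≥ e^3,
  -- which later absorbs the factor 1/4.
  set M : ℝ := N ^ 5 with hM
  have hM32 : 32 ≤ M := by
    calc (32 : ℝ) = 2 ^ 5 := by norm_num
      _ ≤ M := pow_le_pow_left₀ (by norm_num) hN2 5
  have hM0 : 0 < M := by linarith
  set c : ℝ := 1 / (16 * M ^ 2) with hc
  have hc0 : 0 < c := by positivity
  refine ⟨c, hc0, ?_⟩
  have hlim : Tendsto (fun β => Real.exp (c * β)) atTop atTop :=
    Real.tendsto_exp_atTop.comp (tendsto_id.const_mul_atTop hc0)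
  filter_upwards [hlim.eventually_ge_atTop (82 * M), eventually_ge_atTop 0] with β h1 hβ
  set e := Real.exp (c * β) with he
  have he0 : 0 < e := Real.exp_pos _
  -- With c = 1/(16M^2), the bound M^2 exp(-β/(4M^2)) is exactly r^2. The recursion then runs for
  -- about e^2/(41M) steps, at least e of them once e ≥ 82M.
  set r : ℝ := M / e ^ 2 with hr
  have hr0 : 0 < r := by positivity
  have hr40 : 40 * r ≤ 1 := by
    rw [hr, ← mul_div_assoc, div_le_one (by positivity)]
    nlinarith
  have hD : ∀ (n : ℕ) (x : HLattice d L),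
      percMeasure d L d β (giantsApart (children n 5 x)) ≤ ENNReal.ofReal (r ^ 2) := by
    intro n x
    refine (measure_giantsApart_le hβ n 5 x).trans (le_of_eq ?_)
    have he4 : (e ^ 2) ^ 2 = Real.exp (4 * (c * β)) := by
      rw [← pow_mul, he, ← Real.exp_nat_mul]
      norm_num
    rw [← hN, ← hM, hr, div_pow, he4, div_eq_mul_inv (M ^ 2) (Real.exp _), ← Real.exp_neg]
    congr 4
    rw [hc]
    field_simp
    norm_num
  set j := ⌊1 / (41 * r)⌋₊ with hj
  have hj1 : 41 * r * j ≤ 1 := by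
    have : (j : ℝ) ≤ 1 / (41 * r) := Nat.floor_le (by positivity)
    rw [le_div_iff₀ (by positivity)] at this
    linarith
  have hj2 : e ≤ j := by
    have h2 : 1 / (41 * r) < j + 1 := Nat.lt_floor_add_one _
    have h3 : 1 / (41 * r) = e ^ 2 / (41 * M) := by
      rw [hr]
      field_simp
    have h4 : 2 * e ≤ e ^ 2 / (41 * M) := by
      rw [le_div_iff₀ (by positivity)]
      nlinarith
    linarith
  have hmom := (defect_moments_le hr0.le (by rw [← hN, ← hM]; linarith) hD j hj1 0).2
  refine le_trans (ENNReal.ofReal_le_ofReal ?_) ((card_block_le_meanSize ?_ hmom).trans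
    (meanSize_le_susceptibility _))
  · rw [← hN, pow_mul, ← hM]
    have h5 : Real.exp 3 ≤ M := by
      have h27 : Real.exp 3 = Real.exp 1 ^ 3 := by rw [← Real.exp_nat_mul]; norm_num
      have h28 : Real.exp 1 ^ 3 ≤ 2.72 ^ 3 := by
        gcongr
        linarith [Real.exp_one_lt_d9]
      rw [h27]
      refine h28.trans (le_trans ?_ hM32)
      norm_num
    have h6 : (4 : ℝ) ≤ Real.exp 3 := by linarith [Real.add_one_le_exp (3 : ℝ)]
    rw [le_div_iff₀ (by norm_num)]
    calc Real.exp e * 4 ≤ Real.exp j * Real.exp 3 := by gcongr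
      _ = Real.exp (j + 3) := (Real.exp_add _ _).symm
      _ ≤ Real.exp (j * 3) := by
          gcongr
          linarith
      _ = Real.exp 3 ^ j := by rw [← Real.exp_nat_mul]
      _ ≤ M ^ j := by gcongr
  · nlinarith

end

end HLattice

theorem theorem1p1 (d L : ℕ) (hd : 1 ≤ d) (hL : 2 ≤ L) (α : ℝ) (hα : (d : ℝ) ≤ α) :
    (α = d →
      ∃ c C : ℝ, 0 < c ∧ 0 < C ∧ ∀ᶠ β : ℝ in atTop,
        ENNReal.ofReal (Real.exp (Real.exp (c * β))) ≤ HLattice.susceptibility d L α β ∧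
        HLattice.susceptibility d L α β ≤ ENNReal.ofReal (Real.exp (Real.exp (C * β)))) ∧
    ((d : ℝ) < α →
      ∃ ε : ℝ → ℝ, Tendsto ε atTop (𝓝 0) ∧ ∀ᶠ β : ℝ in atTop,
        HLattice.susceptibility d L α β = ENNReal.ofReal (β ^ ((d : ℝ) / (α - d) - ε β))) := by
  have : NeZero L := ⟨by omega⟩
  refine ⟨?_, HLattice.susceptibility_asymptotics hd hL⟩
  rintro rfl
  obtain ⟨c, hc, h⟩ := HLattice.exp_exp_le_susceptibility hL hd
  exact ⟨c, 4, hc, by norm_num, h.and (HLattice.susceptibility_le_exp_exp hL hd)⟩
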